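/- Let $\mathcal S$ be the class of schlicht functions, i.e. of all injective holomorphic functions $f$ on the open unit disk $\mathbb D$ with $f(0)=0$ and $f'(0)=1$. Let $(\lambda_j)_{j\ge1}$ be a positive sequence with $\sum_j\lambda_j<\infty$, let $(r_j)_{j\ge1}$ be a sequence in $(0,1)$ with $r_j\to1$, and suppose that there are constants $0<\lambda<1$ and $\alpha>0$ such that $\lambda_j\asymp\lambda^j$ and $1-r_j\asymp j^{-\alpha}$. Equip $\mathcal S$ with the metric $$d(f,g)=\sum_{j\ge1}\lambda_j\min\Bigl\{1,\max_{|z|\le r_j}|f(z)-g(z)|\Bigr\},$$ and let $N_{\mathcal S}(\delta)$ be the minimal number of closed balls of radius $\delta$ (with centres in $\mathcal S$) needed to cover $\mathcal S$. Then $N_{\mathcal S}(\delta)<\infty$ for every $\delta>0$, and $$\bigl(\log(1/\delta)\bigr)^2\lesssim\log N_{\mathcal S}(\delta)\lesssim\bigl(\log(1/\delta)\bigr)^{2+\alpha}\qquad(\delta\to0^+).$$ In particular, the box-counting dimension $\lim_{\delta\to0^+}\log N_{\mathcal S}(\delta)/\log(1/\delta)$ of $\mathcal S$ is infinite. Here $a\lesssim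 b$ means that $a/b$ remains bounded above, and $a\asymp b$ means that $a\lesssim b$ and $b\lesssim a$. -/

import Mathlib

open Filter Topology Asymptotics
open scoped NNReal ENNReal

noncomputable section

namespace Schlicht

/-- The weights `lam j` and the radii `r j` (`j = 1, 2, …`) that define the metric: `(lam j)` is a
positive summable sequence, and `(r j)` is a sequence in `(0, 1)` that tends to `1`. -/
structure MetricData where
  lam : ℕ+ → ℝ
  r : ℕ+ → ℝ
  lam_pos : ∀ j, 0 < lam j
  summable_lam : Summable lam
  r_pos : ∀ j, 0 < r j
  r_lt_one : ∀ j, r j < 1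
  tendsto_r : Tendsto r atTop (𝓝 1)

/-- `Hol(𝔻)`, the holomorphic functions on the open unit disk. Such a function is represented by
its extension by zero to `ℂ`, so that two elements are equal exactly if they agree on the disk.
The parameter `D` only serves to select the metric. -/
@[ext]
structure Hol (D : MetricData) where
  toFun : ℂ → ℂ
  holo : DifferentiableOn ℂ toFun (Metric.ball 0 1)
  zero_outside : ∀ z, z ∉ Metric.ball (0 : ℂ) 1 → toFun z = 0

variable {D : MetricData}

/-- `max_{|z| ≤ s} |f z - g z|` (for `0 ≤ s < 1` the supremum is attained). -/
def supDist (s : ℝ) (f g : Hol D) : ℝ :=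
  ⨆ z : Metric.closedBall (0 : ℂ) s, ‖f.toFun z - g.toFun z‖

/-- `d(f, g) = ∑_{j ≥ 1} lam j * min {1, max_{|z| ≤ r j} |f z - g z|}`. -/
def holDist (f g : Hol D) : ℝ :=
  ∑' j : ℕ+, D.lam j * min 1 (supDist (D.r j) f g)

theorem supDist_bddAbove {s : ℝ} (hs : s < 1) (f g : Hol D) :
    BddAbove (Set.range fun z : Metric.closedBall (0 : ℂ) s => ‖f.toFun z - g.toFun z‖) := by
  have hsub : Metric.closedBall (0 : ℂ) s ⊆ Metric.ball 0 1 := Metric.closedBall_subset_ball hs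
  have hc : ContinuousOn (fun z => ‖f.toFun z - g.toFun z‖) (Metric.closedBall (0 : ℂ) s) :=
    ((f.holo.continuousOn.mono hsub).sub (g.holo.continuousOn.mono hsub)).norm
  have h := (isCompact_closedBall (0 : ℂ) s).bddAbove_image hc
  rwa [Set.image_eq_range] at h

theorem le_supDist {s : ℝ} (hs : s < 1) (f g : Hol D) {z : ℂ} (hz : ‖z‖ ≤ s) :
    ‖f.toFun z - g.toFun z‖ ≤ supDist s f g :=
  le_ciSup (supDist_bddAbove hs f g) (⟨z, by simpa using hz⟩ : Metric.closedBall (0 : ℂ) s)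

theorem supDist_nonneg (s : ℝ) (f g : Hol D) : 0 ≤ supDist s f g :=
  Real.iSup_nonneg fun _ => norm_nonneg _

theorem supDist_triangle {s : ℝ} (hs0 : 0 < s) (hs : s < 1) (f g h : Hol D) :
    supDist s f h ≤ supDist s f g + supDist s g h := by
  have : Nonempty (Metric.closedBall (0 : ℂ) s) := ⟨⟨0, by simpa using hs0.le⟩⟩
  refine ciSup_le fun z => ?_
  have hz : ‖(z : ℂ)‖ ≤ s := mem_closedBall_zero_iff.1 z.2
  exact (norm_sub_le_norm_sub_add_norm_sub _ (g.toFun z) _).trans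
    (add_le_add (le_supDist hs f g hz) (le_supDist hs g h hz))

theorem term_nonneg (f g : Hol D) (j : ℕ+) : 0 ≤ D.lam j * min 1 (supDist (D.r j) f g) :=
  mul_nonneg (D.lam_pos j).le (le_min zero_le_one (supDist_nonneg _ f g))

theorem summable_term (f g : Hol D) :
    Summable fun j => D.lam j * min 1 (supDist (D.r j) f g) :=
  D.summable_lam.of_nonneg_of_le (term_nonneg f g) fun j =>
    mul_le_of_le_one_right (D.lam_pos j).le (min_le_left _ _)

theorem eq_of_holDist_eq_zero {f g : Hol D} (h : holDist f g = 0) : f = g := by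
  have h0 : ∀ j, supDist (D.r j) f g = 0 := fun j => by
    have h1 := (summable_term f g).hasSum
    rw [show (∑' j, D.lam j * min 1 (supDist (D.r j) f g)) = 0 from h,
      hasSum_zero_iff_of_nonneg (term_nonneg f g)] at h1
    have h2 : D.lam j * min 1 (supDist (D.r j) f g) = 0 := congrFun h1 j
    have h3 := (mul_eq_zero.1 h2).resolve_left (D.lam_pos j).ne'
    rcases min_choice 1 (supDist (D.r j) f g) with h4 | h4 <;> rw [h4] at h3
    · exact absurd h3 one_ne_zero
    · exact h3
  ext z
  by_cases hz : z ∈ Metric.ball (0 : ℂ) 1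
  · obtain ⟨j, hj⟩ := (D.tendsto_r.eventually (lt_mem_nhds (mem_ball_zero_iff.1 hz))).exists
    exact sub_eq_zero.1 (norm_le_zero_iff.1 ((le_supDist (D.r_lt_one j) f g hj.le).trans_eq (h0 j)))
  · rw [f.zero_outside z hz, g.zero_outside z hz]

/-- `Hol(𝔻)` with the metric `d`. -/
instance : MetricSpace (Hol D) where
  dist := holDist
  dist_self f := by simp [holDist, supDist]
  dist_comm f g := by simp only [holDist, supDist, norm_sub_rev]
  dist_triangle f g h := by
    unfold holDist
    rw [← (summable_term f g).tsum_add (summable_term g h)]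
    refine (summable_term f h).tsum_le_tsum (fun j => ?_)
      ((summable_term f g).add (summable_term g h))
    rw [← mul_add]
    refine mul_le_mul_of_nonneg_left ?_ (D.lam_pos j).le
    have h1 := supDist_triangle (D.r_pos j) (D.r_lt_one j) f g h
    have h2 := supDist_nonneg (D.r j) f g
    have h3 := supDist_nonneg (D.r j) g h
    rcases min_cases 1 (supDist (D.r j) f g) with ⟨h4, -⟩ | ⟨h4, -⟩ <;>
    rcases min_cases 1 (supDist (D.r j) g h) with ⟨h5, -⟩ | ⟨h5, -⟩ <;>
    rcases min_cases 1 (supDist (D.r j) f h) with ⟨h6, h7⟩ | ⟨h6, h7⟩ <;>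
    rw [h4, h5, h6] <;> linarith
  eq_of_dist_eq_zero h := eq_of_holDist_eq_zero h

/-- The class `𝒮` of schlicht functions: the holomorphic functions `f` on the open unit disk that
are injective there and satisfy `f 0 = 0` and `f' 0 = 1`. -/
def schlichtClass (D : MetricData) : Set (Hol D) :=
  {f | Set.InjOn f.toFun (Metric.ball 0 1) ∧ f.toFun 0 = 0 ∧ deriv f.toFun 0 = 1}

/-- `log N_A(δ)` for finite `N_A(δ)`, where `N_A(δ)` is the least number of closed balls of
radius `δ`, with centres in `A`, that are needed to cover `A`. -/
def logCovering {X : Type*} [MetricSpace X] (A : Set X) (δ : ℝ≥0) : ℝ :=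
  Real.log (Metric.coveringNumber δ A).toNat

/-- `A`, as a metric space with the induced metric, has box-counting dimension `b`:
`log N_A(δ) / log (1 / δ)` tends to `b` as `δ → 0⁺` (here `log ∞ = ∞`). -/
def HasBoxDim {X : Type*} [MetricSpace X] (A : Set X) (b : EReal) : Prop :=
  Tendsto (fun δ : ℝ≥0 => ENNReal.log (Metric.coveringNumber δ A : ℝ≥0∞) /
    ((Real.log (1 / (δ : ℝ)) : ℝ) : EReal)) (𝓝[>] 0) (𝓝 b)

end Schlicht

end

noncomputable section

namespace Schlicht

open Complex MeasureTheory Metric Set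

variable {D : MetricData}

/-! Write `L = log (1/δ)`. The upper bound rests on polynomial growth: every schlicht `f` satisfies
`|f z| ≤ (1 - |z|)⁻²⁸`. The exponent is far from the sharp one, but powers of `1 - |z|` only cost
factors polynomial in `L`, which exponentials absorb. For the growth bound, write `f = w / v²`; the
odd function `h z = z / v (z²)` is injective, and comparing the area of the image of an annulus
under `1/h` with that of a disc containing it gives `|v' 0| ≤ 7` (`norm_deriv_sqrt_le`), hence `|f''
0| ≤ 28`. Rescaling moves this to any point, and integrating along a radius bounds `f'` and `f`.

Up to an error well below `δ`, only the first `J ≍ L` terms of the metric count, since `lam j`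
decays geometrically. Their radii are at most `1 - 2η` with `η ≍ L^(-α)`. By Cauchy's estimates on
`|z| = 1 - η`, the first `n ≍ L / η ≍ L^(1+α)` Taylor coefficients determine `f` there up to `δ`.
Rounding each of them, scaled by `(1 - 2η)^k`, to precision `e^(-2L)` leaves `e^(O(L))`
possibilities, so `log N ≲ n L ≍ L^(2+α)`.

For the lower bound, `z + ∑ c_k z^(k+2)` is schlicht when `∑ (k+2) |c_k| < 1`. Taking `n ≍ L`
coefficients from a grid of about `e^(L/4)` points of mesh `e^(-L/2)` gives a family that Parseval's
identity on `|z| = r 1` shows to be `2δ`-separated, and the logarithm of its size is `≍ L²`. -/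

/-! ### Square-root transform and area bound for the second coefficient -/

/-- The quotient `q = f w / w` has no zeros because `f` is injective, so `q' / q` has a primitive
`L` on the disk, and `v = exp (-L / 2)` is a branch of `q^(-1/2)`. -/
theorem exists_sqrt_div_id {f : ℂ → ℂ} (hf : DifferentiableOn ℂ f (ball 0 1))
    (hinj : InjOn f (ball 0 1)) (h0 : f 0 = 0) (h1 : deriv f 0 = 1) :
    ∃ v : ℂ → ℂ, DifferentiableOn ℂ v (ball 0 1) ∧ v 0 = 1 ∧ (∀ w, v w ≠ 0) ∧
      ∀ w ∈ ball (0 : ℂ) 1, f w * v w ^ 2 = w := by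
  have hmem : (0 : ℂ) ∈ ball (0 : ℂ) 1 := mem_ball_self one_pos
  set q := dslope f 0 with hq
  have hqd : DifferentiableOn ℂ q (ball 0 1) :=
    (differentiableOn_dslope (isOpen_ball.mem_nhds hmem)).2 hf
  have hfq : ∀ w, f w = w * q w := fun w => by
    have := sub_smul_dslope f 0 w
    simp only [sub_zero, smul_eq_mul, h0] at this
    exact this.symm
  have hqne : ∀ w ∈ ball (0 : ℂ) 1, q w ≠ 0 := fun w hw h => by
    by_cases hw0 : w = 0
    · rw [hw0, hq, dslope_same, h1] at h
      exact one_ne_zero h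
    · exact hw0 (hinj hw hmem (by rw [hfq w, h, h0, mul_zero]))
  have hd : DifferentiableOn ℂ (fun w => deriv q w / q w) (ball 0 1) :=
    (hqd.deriv isOpen_ball).div hqd hqne
  obtain ⟨L, hL0, hL⟩ := hd.isExactOn_ball.with_val_at 0 0
  have hE : ∀ w ∈ ball (0 : ℂ) 1, q w * exp (-L w) = 1 := by
    have hder : ∀ w ∈ ball (0 : ℂ) 1, HasDerivAt (fun w => q w * exp (-L w)) 0 w := fun w hw => by
      have h2 := (hqd.differentiableAt (isOpen_ball.mem_nhds hw)).hasDerivAt.mul (hL w hw).neg.cexp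
      have := hqne w hw
      exact h2.congr_deriv (by field_simp; ring)
    intro w hw
    have h4 := isOpen_ball.is_const_of_deriv_eq_zero (convex_ball (0 : ℂ) 1).isPreconnected
      (f := fun w => q w * exp (-L w))
      (fun w hw => (hder w hw).differentiableAt.differentiableWithinAt)
      (fun w hw => (hder w hw).deriv) hw hmem
    simp only [hL0, neg_zero, exp_zero, mul_one] at h4
    rw [h4, hq, dslope_same, h1]
  refine ⟨fun w => exp (-L w / 2), ?_, by simp [hL0], fun w => exp_ne_zero _, fun w hw => ?_⟩
  · exact fun w hw => ((hL w hw).neg.div_const 2).cexp.differentiableAt.differentiableWithinAt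
  · rw [← exp_nat_mul, hfq, mul_assoc]
    have : ((2 : ℕ) : ℂ) * (-L w / 2) = -L w := by push_cast; ring
    rw [this, hE w hw, mul_one]

/-- The image of the open disc is open, and its boundary points are values on `‖z‖ = ρ`, hence lie
outside `ball 0 m`. So the image is relatively clopen in the connected set `ball 0 m`, and it
contains `0`. -/
theorem ball_subset_image_ball {h : ℂ → ℂ} (hh : DifferentiableOn ℂ h (ball 0 1)) (h0 : h 0 = 0)
    {ρ m : ℝ} (hρ0 : 0 < ρ) (hρ1 : ρ < 1) (hm0 : 0 < m) (hm : ∀ z, ‖z‖ = ρ → m ≤ ‖h z‖) :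
    ball 0 m ⊆ h '' ball 0 ρ := by
  have hsub : closedBall (0 : ℂ) ρ ⊆ ball 0 1 := closedBall_subset_ball hρ1
  have han : AnalyticOnNhd ℂ h (ball 0 ρ) :=
    (hh.mono (ball_subset_closedBall.trans hsub)).analyticOnNhd isOpen_ball
  have hcont : ContinuousOn h (closedBall 0 ρ) := hh.continuousOn.mono hsub
  have hopen : IsOpen (h '' ball 0 ρ) := by
    rcases han.is_constant_or_isOpen (convex_ball (0 : ℂ) ρ).isPreconnected with ⟨w, hw⟩ | h1
    · exfalso
      have hw0 : w = 0 := by rw [← hw 0 (mem_ball_self hρ0), h0]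
      have h2 : EqOn h (fun _ => 0) (closure (ball 0 ρ)) := by
        refine Set.EqOn.of_subset_closure (s := ball 0 ρ) (fun z hz => by rw [hw z hz, hw0]) ?_
          continuousOn_const subset_closure subset_rfl
        rwa [closure_ball _ hρ0.ne']
      have h3 := h2 (x := (ρ : ℂ)) (by
        rw [closure_ball _ hρ0.ne', mem_closedBall_zero_iff]; simp [abs_of_pos hρ0])
      have h4 := hm ρ (by simp [abs_of_pos hρ0])
      rw [h3, norm_zero] at h4
      linarith
    · exact h1 _ subset_rfl isOpen_ball
  refine (convex_ball (0 : ℂ) m).isPreconnected.subset_of_closure_inter_subset hopen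
    ⟨0, mem_ball_self hm0, 0, mem_ball_self hρ0, h0⟩ ?_
  rintro w ⟨hw, hwm⟩
  have hcl : closure (h '' ball 0 ρ) ⊆ h '' closedBall 0 ρ :=
    closure_minimal (image_mono ball_subset_closedBall)
      ((isCompact_closedBall (0 : ℂ) ρ).image_of_continuousOn hcont).isClosed
  obtain ⟨z, hz, rfl⟩ := hcl hw
  rcases (mem_closedBall_zero_iff.1 hz).lt_or_eq with h5 | h5
  · exact ⟨z, mem_ball_zero_iff.2 h5, rfl⟩
  · exact absurd (mem_ball_zero_iff.1 hwm) (not_lt.2 (hm z h5))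

/-- The open annulus `ρ < ‖z‖ < s`. -/
def annulus (ρ s : ℝ) : Set ℂ := {z | ρ < ‖z‖ ∧ ‖z‖ < s}

theorem isOpen_annulus (ρ s : ℝ) : IsOpen (annulus ρ s) :=
  (isOpen_lt continuous_const continuous_norm).inter (isOpen_lt continuous_norm continuous_const)

/-- The integral is the area of `g '' A`: the real Jacobian of multiplication by `g' z` is `‖g' z‖ ^
2`. -/
theorem integral_normSq_deriv_le {g g' : ℂ → ℂ} {A : Set ℂ} (hA : MeasurableSet A) {R : ℝ}
    (hR : 0 ≤ R)
    (hg : ∀ z ∈ A, HasDerivAt g (g' z) z) (hinj : InjOn g A) (hb : ∀ z ∈ A, ‖g z‖ ≤ R) :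
    ∫ z in A, ‖g' z‖ ^ 2 ≤ Real.pi * R ^ 2 := by
  have h1 := integral_image_eq_integral_abs_det_fderiv_smul volume hA
    (f' := fun z => (ContinuousLinearMap.toSpanSingleton ℂ (g' z)).restrictScalars ℝ)
    (fun z hz => ((hg z hz).hasFDerivAt.restrictScalars ℝ).hasFDerivWithinAt) hinj
    (fun _ => (1 : ℝ))
  have hdet : ∀ z, |((ContinuousLinearMap.toSpanSingleton ℂ (g' z)).restrictScalars ℝ).det|
      = ‖g' z‖ ^ 2 := fun z => by
    simp [ContinuousLinearMap.det, LinearMap.det_restrictScalars, Algebra.norm_complex_eq,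
      Complex.normSq_eq_norm_sq]
  simp only [hdet, smul_eq_mul, mul_one] at h1
  rw [← h1, setIntegral_const, smul_eq_mul, mul_one]
  have h2 : g '' A ⊆ closedBall 0 R := by
    rintro _ ⟨z, hz, rfl⟩
    exact mem_closedBall_zero_iff.2 (hb z hz)
  refine (measureReal_mono h2 (isCompact_closedBall (0 : ℂ) R).measure_lt_top.ne).trans_eq ?_
  rw [measureReal_def, Complex.volume_closedBall]
  simp [ENNReal.toReal_ofReal hR, mul_comm]

theorem integral_re_circleMap_eq_zero {E : ℂ → ℂ} {r : ℝ} (hr : 0 < r)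
    (hE : DifferentiableOn ℂ E (closedBall 0 r)) (h0 : E 0 = 0) :
    ∫ θ in Ioo (-Real.pi) Real.pi, (E (circleMap 0 r θ)).re = 0 := by
  have hc : Continuous fun θ => E (circleMap 0 r θ) :=
    hE.continuousOn.comp_continuous (continuous_circleMap 0 r) fun θ =>
      circleMap_mem_closedBall 0 hr.le θ
  have h1 := DiffContOnCl.circleAverage (f := E) (c := 0) (R := r) (by
    rw [abs_of_pos hr]
    exact ⟨hE.mono ball_subset_closedBall, by rw [closure_ball _ hr.ne']; exact hE.continuousOn⟩)
  rw [Real.circleAverage, h0, smul_eq_zero] at h1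
  have h2 := h1.resolve_left (by positivity)
  have h3 : Function.Periodic (fun θ => E (circleMap 0 r θ)) (2 * Real.pi) := fun θ => by
    simp only [periodic_circleMap 0 r θ]
  have h4 := h3.intervalIntegral_add_eq 0 (-Real.pi)
  rw [zero_add, h2, show -Real.pi + 2 * Real.pi = Real.pi by ring] at h4
  rw [← integral_Ioc_eq_integral_Ioo, ← intervalIntegral.integral_of_le (by linarith [Real.pi_pos])]
  have h5 := reCLM.intervalIntegral_comp_comm
    (hc.intervalIntegrable (μ := volume) (-Real.pi) Real.pi)
  simp only [reCLM_apply] at h5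
  rw [h5, ← h4, zero_re]

theorem polarCoord_symm_eq_circleMap (p : ℝ × ℝ) :
    Complex.polarCoord.symm p = circleMap 0 p.1 p.2 := by
  rw [Complex.polarCoord_symm_apply, circleMap, zero_add, exp_mul_I]
  push_cast
  ring

theorem setIntegral_annulus {F : ℂ → ℝ} {ρ s : ℝ} (hρ : 0 < ρ)
    (hF : ContinuousOn F {z | ρ ≤ ‖z‖ ∧ ‖z‖ ≤ s}) :
    IntegrableOn (fun r => r * ∫ θ in Ioo (-Real.pi) Real.pi, F (circleMap 0 r θ)) (Ioo ρ s) ∧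
    ∫ z in annulus ρ s, F z =
      ∫ r in Ioo ρ s, r * ∫ θ in Ioo (-Real.pi) Real.pi, F (circleMap 0 r θ) := by
  rw [← integral_indicator (isOpen_annulus ρ s).measurableSet,
    ← Complex.integral_comp_polarCoord_symm, polarCoord_target,
    ← integral_indicator (measurableSet_Ioi.prod measurableSet_Ioo)]
  have h1 : (fun p : ℝ × ℝ => (Ioi (0 : ℝ) ×ˢ Ioo (-Real.pi) Real.pi).indicator
      (fun p => p.1 • (annulus ρ s).indicator F (Complex.polarCoord.symm p)) p) =
      (Ioo ρ s ×ˢ Ioo (-Real.pi) Real.pi).indicator fun p => p.1 * F (circleMap 0 p.1 p.2) := by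
    ext p
    by_cases hp : p ∈ Ioo ρ s ×ˢ Ioo (-Real.pi) Real.pi
    · have hp0 : 0 < p.1 := hρ.trans hp.1.1
      rw [indicator_of_mem hp, indicator_of_mem (show p ∈ Ioi (0 : ℝ) ×ˢ Ioo (-Real.pi) Real.pi from
        ⟨hp0, hp.2⟩), polarCoord_symm_eq_circleMap, indicator_of_mem, smul_eq_mul]
      simp only [annulus, mem_ofPred_eq, norm_circleMap_zero, abs_of_pos hp0]
      exact hp.1
    · rw [indicator_of_notMem hp]
      by_cases hp' : p ∈ Ioi (0 : ℝ) ×ˢ Ioo (-Real.pi) Real.pi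
      · rw [indicator_of_mem hp', polarCoord_symm_eq_circleMap, indicator_of_notMem, smul_zero]
        intro h
        simp only [annulus, mem_ofPred_eq, norm_circleMap_zero,
          abs_of_pos (show 0 < p.1 from hp'.1)]
          at h
        exact hp ⟨h, hp'.2⟩
      · rw [indicator_of_notMem hp']
  have h2 : IntegrableOn (fun p : ℝ × ℝ => p.1 * F (circleMap 0 p.1 p.2))
      (Ioo ρ s ×ˢ Ioo (-Real.pi) Real.pi) := by
    refine IntegrableOn.mono_set (t := Icc ρ s ×ˢ Icc (-Real.pi) Real.pi) ?_
      (prod_mono Ioo_subset_Icc_self Ioo_subset_Icc_self)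
    refine ContinuousOn.integrableOn_compact (isCompact_Icc.prod isCompact_Icc) ?_
    refine continuousOn_fst.mul (hF.comp (f := fun p : ℝ × ℝ => circleMap 0 p.1 p.2) ?_ ?_)
    · simp only [circleMap]
      fun_prop
    · intro p hp
      simp only [mem_ofPred_eq, norm_circleMap_zero, abs_of_pos (hρ.trans_le hp.1.1)]
      exact hp.1
  rw [h1, integral_indicator (measurableSet_Ioo.prod measurableSet_Ioo),
    Measure.volume_eq_prod, setIntegral_prod _ h2]
  rw [IntegrableOn, Measure.volume_eq_prod, ← Measure.prod_restrict] at h2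
  have h3 := h2.integral_prod_left
  simp_rw [integral_const_mul] at h3 ⊢
  exact ⟨h3, trivial⟩

theorem integral_Ioo_inv_cube_add {ρ s a : ℝ} (hρ : 0 < ρ) (hs : ρ < s) :
    ∫ r in Ioo ρ s, r * (2 * Real.pi * ((r ^ 4)⁻¹ + a)) =
      Real.pi * (1 / ρ ^ 2 - 1 / s ^ 2 + a * (s ^ 2 - ρ ^ 2)) := by
  rw [← integral_Ioc_eq_integral_Ioo, ← intervalIntegral.integral_of_le hs.le]
  have hd : ∀ x ∈ uIcc ρ s, HasDerivAt (fun r : ℝ => Real.pi * (a * r ^ 2 - (r ^ 2)⁻¹))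
      (x * (2 * Real.pi * ((x ^ 4)⁻¹ + a))) x := fun x hx => by
    rw [uIcc_of_le hs.le] at hx
    have hx0 : x ≠ 0 := (hρ.trans_le hx.1).ne'
    have := (((hasDerivAt_pow 2 x).const_mul a).sub
      ((hasDerivAt_pow 2 x).inv (pow_ne_zero 2 hx0))).const_mul Real.pi
    refine this.congr_deriv ?_
    push_cast
    field_simp
    ring
  rw [intervalIntegral.integral_eq_sub_of_hasDerivAt hd]
  · have := (hρ.trans hs).ne'
    field_simp
    ring
  · refine ContinuousOn.intervalIntegrable fun x hx => ?_
    rw [uIcc_of_le hs.le] at hx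
    have hx0 : x ≠ 0 := (hρ.trans_le hx.1).ne'
    exact ContinuousAt.continuousWithinAt (by fun_prop (disch := positivity))

/-- On each circle the mean of the integrand is at least `r⁻⁴ + ‖ψ 0‖ ^ 2`, as orthogonality of
powers of `z` suggests; a pointwise minorant and the mean value property give this without a Laurent
expansion. -/
theorem le_integral_normSq_sub_inv_sq {ψ : ℂ → ℂ} (hψ : DifferentiableOn ℂ ψ (ball 0 1))
    {ρ s : ℝ} (hρ : 0 < ρ) (hρs : ρ < s) (hs : s < 1) :
    Real.pi * (1 / ρ ^ 2 - 1 / s ^ 2 + ‖ψ 0‖ ^ 2 * (s ^ 2 - ρ ^ 2)) ≤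
      ∫ z in annulus ρ s, ‖ψ z - (z ^ 2)⁻¹‖ ^ 2 := by
  have hc : ContinuousOn (fun z => ‖ψ z - (z ^ 2)⁻¹‖ ^ 2) {z | ρ ≤ ‖z‖ ∧ ‖z‖ ≤ s} := by
    have h1 : ContinuousOn ψ {z | ρ ≤ ‖z‖ ∧ ‖z‖ ≤ s} := hψ.continuousOn.mono fun z hz =>
      mem_ball_zero_iff.2 (hz.2.trans_lt hs)
    refine ((h1.sub ((continuousOn_id.pow 2).inv₀ fun z hz => ?_)).norm).pow 2
    exact pow_ne_zero 2 (norm_pos_iff.1 (hρ.trans_le hz.1))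
  obtain ⟨hi, he⟩ := setIntegral_annulus hρ hc
  rw [he, ← integral_Ioo_inv_cube_add hρ hρs]
  have hcirc : ∀ r ∈ Icc ρ s, 2 * Real.pi * ((r ^ 4)⁻¹ + ‖ψ 0‖ ^ 2) ≤
      ∫ θ in Ioo (-Real.pi) Real.pi, ‖ψ (circleMap 0 r θ) - (circleMap 0 r θ ^ 2)⁻¹‖ ^ 2 := by
    intro r hr
    have hr0 : 0 < r := hρ.trans_le hr.1
    have hsub : closedBall (0 : ℂ) r ⊆ ball 0 1 := closedBall_subset_ball (hr.2.trans_lt hs)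
    set c := ψ 0 with hcdef
    -- On `‖z‖ = r` the conjugate of `z⁻²` is `z² / r⁴`. Together with `|ψ|² ≥ 2 Re (c̄ ψ) - |c|²`
    -- this bounds the integrand below by `r⁻⁴ + |c|² + 2 Re E`, where `E` is holomorphic and `E 0 =
    -- 0`, so `Re E` has mean zero.
    set E : ℂ → ℂ := fun z => (starRingEnd ℂ) c * (ψ z - c) - z ^ 2 * ψ z / (r : ℂ) ^ 4 with hE
    have hEd : DifferentiableOn ℂ E (closedBall 0 r) := by
      have := hψ.mono hsub
      simp only [hE]
      fun_prop
    have h0 := integral_re_circleMap_eq_zero hr0 hEd (by simp [hE, hcdef])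
    have hEc : Continuous fun θ => (E (circleMap 0 r θ)).re :=
      continuous_re.comp (hEd.continuousOn.comp_continuous (continuous_circleMap 0 r) fun θ =>
        circleMap_mem_closedBall 0 hr0.le θ)
    have hint : ∀ {u : ℝ → ℝ}, Continuous u → IntegrableOn u (Ioo (-Real.pi) Real.pi) := fun hu =>
      (hu.continuousOn.integrableOn_compact isCompact_Icc).mono_set Ioo_subset_Icc_self
    have hval : ∫ θ in Ioo (-Real.pi) Real.pi,
        (((r ^ 4)⁻¹ + ‖c‖ ^ 2) + 2 * (E (circleMap 0 r θ)).re) =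
        2 * Real.pi * ((r ^ 4)⁻¹ + ‖c‖ ^ 2) := by
      rw [integral_add (hint continuous_const) (hint (u := fun θ => 2 * (E (circleMap 0 r θ)).re)
        (continuous_const.mul hEc)),
        integral_const_mul, h0, setIntegral_const, measureReal_def, Real.volume_Ioo,
        ENNReal.toReal_ofReal (by linarith [Real.pi_pos]), smul_eq_mul]
      ring
    rw [← hval]
    refine setIntegral_mono_on (hint (continuous_const.add (continuous_const.mul hEc))) (hint ?_)
      measurableSet_Ioo fun θ _ => ?_
    · refine hc.comp_continuous (continuous_circleMap 0 r) fun θ => ?_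
      simp only [mem_ofPred_eq, norm_circleMap_zero, abs_of_pos hr0]
      exact hr
    · set z := circleMap 0 r θ with hz
      have hzn : ‖z‖ = r := by rw [hz, norm_circleMap_zero, abs_of_pos hr0]
      have hinv : (z ^ 2)⁻¹ = (starRingEnd ℂ) (z ^ 2) / (r : ℂ) ^ 4 := by
        rw [Complex.inv_def, normSq_eq_norm_sq, norm_pow, hzn]
        push_cast
        rw [← pow_mul, div_eq_mul_inv]
      have hn4 : normSq (z ^ 2) = r ^ 4 := by
        rw [normSq_eq_norm_sq, norm_pow, hzn, ← pow_mul]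
      have e1 : ‖ψ z - (z ^ 2)⁻¹‖ ^ 2 = normSq (ψ z) + (r ^ 4)⁻¹ -
          2 * (z ^ 2 * ψ z / (r : ℂ) ^ 4).re := by
        rw [← normSq_eq_norm_sq, normSq_sub, map_inv₀, hn4, hinv]
        congr 3
        rw [map_div₀, conj_conj, map_pow, conj_ofReal]
        ring
      have e2 : 0 ≤ normSq (ψ z) + normSq c - 2 * ((starRingEnd ℂ) c * ψ z).re := by
        have := normSq_nonneg (ψ z - c)
        rwa [normSq_sub, mul_comm (ψ z)] at this
      have e3 : (E z).re = ((starRingEnd ℂ) c * ψ z).re - normSq c -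
          (z ^ 2 * ψ z / (r : ℂ) ^ 4).re := by
        simp only [hE, mul_sub, sub_re]
        rw [← normSq_eq_conj_mul_self, ofReal_re]
      rw [e1, e3, ← normSq_eq_norm_sq]
      linarith
  refine setIntegral_mono_on ?_ hi measurableSet_Ioo fun r hr =>
    mul_le_mul_of_nonneg_left (hcirc r (Ioo_subset_Icc_self hr)) (hρ.trans hr.1).le
  refine (ContinuousOn.integrableOn_compact isCompact_Icc fun x hx => ?_).mono_set
    (Ioo_subset_Icc_self (a := ρ) (b := s))
  have hx0 : x ≠ 0 := (hρ.trans_le hx.1).ne'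
  exact ContinuousAt.continuousWithinAt (by fun_prop (disch := positivity))

/-- Both area estimates for `g = 1 / h` on `ρ < ‖z‖ < 3/4` have leading term `π / ρ²`. After
cancellation a quadratic term in `‖c‖` is bounded by a linear one plus a small quadratic error, so
`‖c‖` is bounded. -/
theorem norm_deriv_sqrt_le {f v : ℂ → ℂ} (hf : InjOn f (ball 0 1))
    (hv : DifferentiableOn ℂ v (ball 0 1)) (hv0 : v 0 = 1) (hvne : ∀ w, v w ≠ 0)
    (hfv : ∀ w ∈ ball (0 : ℂ) 1, f w * v w ^ 2 = w) : ‖deriv v 0‖ ≤ 7 := by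
  have hmem : (0 : ℂ) ∈ ball (0 : ℂ) 1 := mem_ball_self one_pos
  set c := deriv v 0 with hc
  set g : ℂ → ℂ := fun z => v (z ^ 2) / z with hg
  set h : ℂ → ℂ := fun z => z / v (z ^ 2) with hh
  -- This is the holomorphic part of `g'`: since `v 0 = 1`, one has `g' z = ψ z - z⁻²`, and `ψ 0 =
  -- 2c - c = c`.
  set ψ : ℂ → ℂ := fun z => 2 * deriv v (z ^ 2) - dslope v 0 (z ^ 2) with hψ
  have hsq : MapsTo (fun z : ℂ => z ^ 2) (ball 0 1) (ball 0 1) := fun z hz => by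
    rw [mem_ball_zero_iff] at hz ⊢
    rw [norm_pow]
    exact pow_lt_one₀ (norm_nonneg z) hz two_ne_zero
  have hsqd : DifferentiableOn ℂ (fun z : ℂ => z ^ 2) (ball 0 1) := by fun_prop
  have hψd : DifferentiableOn ℂ ψ (ball 0 1) :=
    (((hv.deriv isOpen_ball).comp hsqd hsq).const_mul 2).sub
      (((differentiableOn_dslope (isOpen_ball.mem_nhds hmem)).2 hv).comp hsqd hsq)
  have hψ0 : ψ 0 = c := by simp [hψ, hc]; ring
  have hhd : DifferentiableOn ℂ h (ball 0 1) :=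
    differentiableOn_id.div (hv.comp hsqd hsq) fun z _ => hvne _
  have hh2 : ∀ z ∈ ball (0 : ℂ) 1, h z ^ 2 = f (z ^ 2) := fun z hz => by
    have h1 := hfv _ (hsq hz)
    rw [hh]
    simp only
    rw [div_pow, div_eq_iff (pow_ne_zero 2 (hvne _)), h1]
  have hhinj : InjOn h (ball 0 1) := fun z hz w hw hzw => by
    have h1 : z ^ 2 = w ^ 2 := hf (hsq hz) (hsq hw) (by
      rw [← hh2 z hz, ← hh2 w hw, hzw])
    rcases sq_eq_sq_iff_eq_or_eq_neg.1 h1 with h2 | h2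
    · exact h2
    · simp only [hh, h1] at hzw
      rwa [div_left_inj' (hvne _)] at hzw
  obtain ⟨t, ht0, ht⟩ : ∃ t > 0, ∀ w : ℂ, ‖w‖ < t → ‖v w - 1‖ ≤ (‖c‖ + 1) * ‖w‖ := by
    have h1 := (hv.differentiableAt (isOpen_ball.mem_nhds hmem)).hasDerivAt.isLittleO
    have h2 := Metric.eventually_nhds_iff.1 (h1.bound (c := 1) one_pos)
    obtain ⟨t, ht0, ht⟩ := h2
    refine ⟨t, ht0, fun w hw => ?_⟩
    have h3 := ht (y := w) (by simpa using hw)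
    simp only [sub_zero, hv0, smul_eq_mul, one_mul] at h3
    calc ‖v w - 1‖ = ‖(v w - 1 - w * c) + w * c‖ := by ring_nf
      _ ≤ ‖v w - 1 - w * c‖ + ‖w * c‖ := norm_add_le _ _
      _ ≤ ‖w‖ + ‖w‖ * ‖c‖ := by rw [norm_mul]; gcongr
      _ = _ := by ring
  obtain ⟨ρ, hρ0, hρ4, hρt⟩ : ∃ ρ > 0, ρ ≤ 1 / 4 ∧ ρ ^ 2 < t := by
    refine ⟨min (1 / 4) (t / 2), by positivity, min_le_left _ _, ?_⟩
    have h1 : 0 < min (1 / 4) (t / 2) := by positivity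
    nlinarith [min_le_left (1 / 4) (t / 2), min_le_right (1 / 4) (t / 2)]
  set R := (1 + (‖c‖ + 1) * ρ ^ 2) / ρ with hR
  have hR0 : 0 < R := by positivity
  have hcirc : ∀ z, ‖z‖ = ρ → R⁻¹ ≤ ‖h z‖ := fun z hz => by
    have h1 : ‖v (z ^ 2)‖ ≤ 1 + (‖c‖ + 1) * ρ ^ 2 := by
      have h2 := ht (z ^ 2) (by rwa [norm_pow, hz])
      rw [norm_pow, hz] at h2
      calc ‖v (z ^ 2)‖ = ‖1 + (v (z ^ 2) - 1)‖ := by ring_nf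
        _ ≤ ‖(1 : ℂ)‖ + ‖v (z ^ 2) - 1‖ := norm_add_le _ _
        _ ≤ _ := by rw [norm_one]; gcongr
    rw [hR, inv_div, hh]
    simp only [norm_div, hz]
    have := norm_pos_iff.2 (hvne (z ^ 2))
    gcongr
  have hcov := ball_subset_image_ball hhd (by simp [hh]) hρ0 (by linarith) (inv_pos.2 hR0) hcirc
  have hA : ∀ z ∈ annulus ρ (3 / 4), z ∈ ball (0 : ℂ) 1 ∧ z ≠ 0 := fun z hz =>
    ⟨mem_ball_zero_iff.2 (by linarith [hz.2]), norm_pos_iff.1 (hρ0.trans hz.1)⟩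
  have hgh : ∀ z, g z = (h z)⁻¹ := fun z => by simp [hg, hh]
  -- If `‖g z‖ > R`, then `h z` lies in the disc already covered by `h '' ball 0 ρ`, against
  -- injectivity.
  have hb : ∀ z ∈ annulus ρ (3 / 4), ‖g z‖ ≤ R := fun z hz => by
    by_contra! hlt
    obtain ⟨w, hw, hwz⟩ := hcov (show h z ∈ ball 0 R⁻¹ by
      rw [mem_ball_zero_iff, ← inv_inv (h z), ← hgh, norm_inv]
      exact inv_strictAnti₀ hR0 hlt)
    have hw' := mem_ball_zero_iff.1 hw
    have := hhinj (mem_ball_zero_iff.2 (by linarith)) (hA z hz).1 hwz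
    rw [this] at hw'
    exact lt_asymm hw' hz.1
  have hd : ∀ z ∈ annulus ρ (3 / 4), HasDerivAt g (ψ z - (z ^ 2)⁻¹) z := fun z hz => by
    have hz0 := (hA z hz).2
    have h1 := (hv.differentiableAt (isOpen_ball.mem_nhds (hsq (hA z hz).1))).hasDerivAt
    have h2 := (h1.comp z (hasDerivAt_pow 2 z)).div (hasDerivAt_id z) hz0
    refine h2.congr_deriv ?_
    rw [hψ]
    simp only [dslope_of_ne v (pow_ne_zero 2 hz0), slope_def_field, hv0, Function.comp, id]
    push_cast
    field_simp
    ring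
  have hup := integral_normSq_deriv_le (isOpen_annulus ρ (3 / 4)).measurableSet hR0.le hd
    (fun z hz w hw hzw => hhinj (hA z hz).1 (hA w hw).1 (by
      rw [hgh, hgh] at hzw; exact inv_injective hzw)) hb
  have hlo := le_integral_normSq_sub_inv_sq hψd hρ0 (show ρ < 3 / 4 by linarith) (by norm_num)
  have hfin := le_of_mul_le_mul_left (hlo.trans hup) Real.pi_pos
  have hR2 : R ^ 2 = 1 / ρ ^ 2 + 2 * (‖c‖ + 1) + (‖c‖ + 1) ^ 2 * ρ ^ 2 := by
    rw [hR]; field_simp; ring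
  rw [hR2, hψ0] at hfin
  have hρ2 : ρ ^ 2 ≤ 1 / 16 := by nlinarith
  have hc0 := norm_nonneg c
  have h5 : ‖c‖ ^ 2 * ρ ^ 2 ≤ ‖c‖ ^ 2 * (1 / 16) := by gcongr
  have h6 : (‖c‖ + 1) ^ 2 * ρ ^ 2 ≤ (‖c‖ + 1) ^ 2 * (1 / 16) := by gcongr
  by_contra! hlt
  nlinarith

/-- Differentiating `f v² = w` twice gives `f'' 0 = -4 v' 0`. -/
theorem norm_deriv_deriv_zero_le {f : ℂ → ℂ} (hf : DifferentiableOn ℂ f (ball 0 1))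
    (hinj : InjOn f (ball 0 1)) (h0 : f 0 = 0) (h1 : deriv f 0 = 1) :
    ‖deriv (deriv f) 0‖ ≤ 28 := by
  obtain ⟨v, hv, hv0, hvne, hfv⟩ := exists_sqrt_div_id hf hinj h0 h1
  have hc := norm_deriv_sqrt_le hinj hv hv0 hvne hfv
  have hmem : (0 : ℂ) ∈ ball (0 : ℂ) 1 := mem_ball_self one_pos
  have hnhds := isOpen_ball.mem_nhds hmem
  have hd : ∀ w ∈ ball (0 : ℂ) 1, deriv f w = (1 - 2 * f w * v w * deriv v w) / v w ^ 2 := by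
    intro w hw
    have hw' := isOpen_ball.mem_nhds hw
    have e1 := (hf.differentiableAt hw').hasDerivAt.mul
      ((hv.differentiableAt hw').hasDerivAt.pow 2)
    have e2 : HasDerivAt (fun w => f w * v w ^ 2) 1 w :=
      (hasDerivAt_id w).congr_of_eventuallyEq (by filter_upwards [hw'] with y hy using hfv y hy)
    have e3 := e1.unique e2
    rw [eq_div_iff (pow_ne_zero 2 (hvne w)), ← e3]
    simp only [Pi.pow_apply]
    push_cast
    ring
  have hvd := (hv.differentiableAt hnhds).hasDerivAt
  have hfd := (hf.differentiableAt hnhds).hasDerivAt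
  have hvdd := ((hv.deriv isOpen_ball).differentiableAt hnhds).hasDerivAt
  have e1 := (((hfd.const_mul 2).mul hvd).mul hvdd).const_sub 1
  have e2 := e1.div (hvd.pow 2) (pow_ne_zero 2 (hvne 0))
  have e3 : HasDerivAt (deriv f) (-4 * deriv v 0) 0 := by
    refine (e2.congr_of_eventuallyEq ?_).congr_deriv ?_
    · filter_upwards [hnhds] with w hw
      rw [hd w hw]
      rfl
    · simp only [Pi.mul_apply, Pi.pow_apply, h0, h1, hv0]
      push_cast
      ring
  rw [e3.deriv, norm_mul, norm_neg]
  norm_num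
  linarith

/-! ### Distortion and growth -/

/-- The bound at the origin is applied to the normalised restriction of `f` to the disc of centre
`a` and radius `1 - ‖a‖`. -/
theorem norm_deriv_deriv_le {f : ℂ → ℂ} (hf : DifferentiableOn ℂ f (ball 0 1))
    (hinj : InjOn f (ball 0 1)) {a : ℂ} (ha : ‖a‖ < 1) (hfa : deriv f a ≠ 0) :
    (1 - ‖a‖) * ‖deriv (deriv f) a‖ ≤ 28 * ‖deriv f a‖ := by
  set t : ℝ := 1 - ‖a‖ with ht
  have ht0 : 0 < t := by linarith
  have htc : (t : ℂ) ≠ 0 := by exact_mod_cast ht0.ne'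
  have hmaps : MapsTo (fun z : ℂ => a + t * z) (ball 0 1) (ball 0 1) := fun z hz => by
    rw [mem_ball_zero_iff] at hz ⊢
    calc ‖a + t * z‖ ≤ ‖a‖ + ‖(t : ℂ) * z‖ := norm_add_le _ _
      _ = ‖a‖ + t * ‖z‖ := by rw [norm_mul, norm_real, Real.norm_of_nonneg ht0.le]
      _ < ‖a‖ + t * 1 := by gcongr
      _ = 1 := by rw [ht]; ring
  have hmem : (0 : ℂ) ∈ ball (0 : ℂ) 1 := mem_ball_self one_pos
  have haff : ∀ z : ℂ, HasDerivAt (fun z : ℂ => a + t * z) t z := fun z => by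
    simpa using ((hasDerivAt_id z).const_mul (t : ℂ)).const_add a
  set F : ℂ → ℂ := fun z => (f (a + t * z) - f a) / (t * deriv f a) with hF
  have hD : ∀ z ∈ ball (0 : ℂ) 1, HasDerivAt F (deriv f (a + t * z) / deriv f a) z := by
    intro z hz
    have h1 := (hf.differentiableAt (isOpen_ball.mem_nhds (hmaps hz))).hasDerivAt
    have h2 := ((h1.comp z (haff z)).sub_const (f a)).div_const (t * deriv f a)
    exact h2.congr_deriv (by field_simp)
  have hb := norm_deriv_deriv_zero_le (f := F)
    (fun z hz => (hD z hz).differentiableAt.differentiableWithinAt)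
    (fun z hz w hw hzw => by
      simp only [hF] at hzw
      rw [div_left_inj' (mul_ne_zero htc hfa), sub_left_inj] at hzw
      exact mul_left_cancel₀ htc (add_left_cancel (hinj (hmaps hz) (hmaps hw) hzw)))
    (by simp [hF]) (by rw [(hD 0 hmem).deriv]; simp [hfa])
  have hDD : HasDerivAt (deriv F) (deriv (deriv f) a * t / deriv f a) 0 := by
    have h1 : HasDerivAt (deriv f) (deriv (deriv f) a) (a + t * 0) := by
      rw [mul_zero, add_zero]
      exact ((hf.deriv isOpen_ball).differentiableAt
        (isOpen_ball.mem_nhds (mem_ball_zero_iff.2 ha))).hasDerivAt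
    refine ((h1.comp 0 (haff 0)).div_const (deriv f a)).congr_of_eventuallyEq ?_
    filter_upwards [isOpen_ball.mem_nhds hmem] with z hz
    exact (hD z hz).deriv
  rw [hDD.deriv, norm_div, norm_mul, norm_real, Real.norm_of_nonneg ht0.le,
    div_le_iff₀ (norm_pos_iff.2 hfa)] at hb
  linarith

theorem norm_deriv_le_inv_pow {f : ℂ → ℂ} (hf : DifferentiableOn ℂ f (ball 0 1))
    (hinj : InjOn f (ball 0 1)) (h1 : deriv f 0 = 1) {z : ℂ} (hz : ‖z‖ < 1) :
    ‖deriv f z‖ ≤ ((1 - ‖z‖) ^ 28)⁻¹ := by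
  set p : ℝ → ℂ := fun t => deriv f (t * z) with hp
  have hlt : ∀ t ∈ Icc (0 : ℝ) 1, ‖(t : ℂ) * z‖ = t * ‖z‖ ∧ t * ‖z‖ < 1 := fun t ht => by
    refine ⟨by rw [norm_mul, norm_real, Real.norm_of_nonneg ht.1], ?_⟩
    nlinarith [ht.1, ht.2, norm_nonneg z]
  have hpd : ∀ t ∈ Icc (0 : ℝ) 1, HasDerivAt p (deriv (deriv f) (t * z) * z) t := fun t ht => by
    have e1 := ((hf.deriv isOpen_ball).differentiableAt (isOpen_ball.mem_nhds
      (mem_ball_zero_iff.2 ((hlt t ht).1.trans_lt (hlt t ht).2)))).hasDerivAt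
    have e2 : HasDerivAt (fun t : ℝ => (t : ℂ) * z) z t := by
      simpa using (ofRealCLM.hasDerivAt (x := t)).mul_const z
    exact e1.comp t e2
  -- Squaring keeps the function differentiable where `f'` might vanish, so `f' ≠ 0` need not be
  -- proved; `56 = 2 * 28`.
  set χ : ℝ → ℝ := fun t => ‖p t‖ ^ 2 * (1 - t * ‖z‖) ^ 56 with hχ
  have hχd : ∀ t ∈ Icc (0 : ℝ) 1, HasDerivAt χ
      (2 * inner ℝ (p t) (deriv (deriv f) (t * z) * z) * (1 - t * ‖z‖) ^ 56 +
        ‖p t‖ ^ 2 * (56 * (1 - t * ‖z‖) ^ 55 * (-‖z‖))) t := fun t ht => by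
    have e1 := (hpd t ht).norm_sq
    have e2 : HasDerivAt (fun t : ℝ => 1 - t * ‖z‖) (-‖z‖) t := by
      simpa using ((hasDerivAt_id t).mul_const ‖z‖).const_sub 1
    exact e1.mul (e2.pow 56)
  have hanti : AntitoneOn χ (Icc 0 1) := by
    refine antitoneOn_of_deriv_nonpos (convex_Icc 0 1)
      (fun t ht => (hχd t ht).continuousAt.continuousWithinAt)
      (fun t ht => (hχd t (interior_subset ht)).differentiableAt.differentiableWithinAt)
      fun t ht => ?_
    replace ht := interior_subset ht
    rw [(hχd t ht).deriv]
    obtain ⟨hn, hl⟩ := hlt t ht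
    have e0 : 0 < 1 - t * ‖z‖ := by linarith
    have e1 : inner ℝ (p t) (deriv (deriv f) (t * z) * z) * (1 - t * ‖z‖) ≤
        28 * ‖p t‖ ^ 2 * ‖z‖ := by
      by_cases h0 : p t = 0
      · simp [h0]
      · have e2 := norm_deriv_deriv_le hf hinj (hn.trans_lt hl) h0
        rw [hn] at e2
        calc _ ≤ ‖p t‖ * ‖deriv (deriv f) (t * z) * z‖ * (1 - t * ‖z‖) := by
              gcongr
              exact real_inner_le_norm _ _
          _ = ‖p t‖ * ‖z‖ * ((1 - t * ‖z‖) * ‖deriv (deriv f) (t * z)‖) := by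
              rw [norm_mul]; ring
          _ ≤ ‖p t‖ * ‖z‖ * (28 * ‖p t‖) := by gcongr
          _ = _ := by ring
    have e3 : 0 < (1 - t * ‖z‖) ^ 55 := by positivity
    have e4 := mul_le_mul_of_nonneg_right e1 e3.le
    rw [pow_succ (1 - t * ‖z‖) 55]
    linarith
  have h2 := hanti (left_mem_Icc.2 zero_le_one) (right_mem_Icc.2 zero_le_one) zero_le_one
  simp only [hχ, hp, h1, ofReal_one, one_mul, ofReal_zero, zero_mul, norm_one, sub_zero,
    one_pow] at h2
  have h3 : 0 < 1 - ‖z‖ := by linarith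
  rw [← one_div, le_div_iff₀ (by positivity)]
  refine le_of_sq_le_sq ?_ zero_le_one
  rw [mul_pow, ← pow_mul]
  simpa using h2

theorem norm_le_inv_pow {f : ℂ → ℂ} (hf : DifferentiableOn ℂ f (ball 0 1))
    (hinj : InjOn f (ball 0 1)) (h0 : f 0 = 0) (h1 : deriv f 0 = 1) {z : ℂ} (hz : ‖z‖ < 1) :
    ‖f z‖ ≤ ((1 - ‖z‖) ^ 28)⁻¹ := by
  have h3 : 0 < 1 - ‖z‖ := by linarith
  have h2 := (convex_closedBall (0 : ℂ) ‖z‖).norm_image_sub_le_of_norm_deriv_le (f := f)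
    (C := ((1 - ‖z‖) ^ 28)⁻¹)
    (fun w hw => hf.differentiableAt (isOpen_ball.mem_nhds
      (closedBall_subset_ball hz hw)))
    (fun w hw => ?_) (mem_closedBall_self (norm_nonneg z)) (mem_closedBall_zero_iff.2 le_rfl)
  · rw [h0, sub_zero, sub_zero] at h2
    exact h2.trans (mul_le_of_le_one_right (by positivity) hz.le)
  · have hw' := mem_closedBall_zero_iff.1 hw
    refine (norm_deriv_le_inv_pow hf hinj h1 (hw'.trans_lt hz)).trans ?_
    gcongr

/-! ### Upper bound: quantized Taylor coefficients -/

/-- One point of `A` from each nonempty fibre of `Φ` serves as a centre. -/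
theorem coveringNumber_le_card {X T : Type*} [MetricSpace X] [Fintype T] {A : Set X} (Φ : X → T)
    {δ : ℝ≥0} (h : ∀ x ∈ A, ∀ y ∈ A, Φ x = Φ y → dist x y ≤ δ) :
    coveringNumber δ A ≤ (Fintype.card T : ℕ∞) := by
  obtain ⟨C, hCA, hC⟩ := exists_subset_bijOn A Φ
  refine (IsCover.coveringNumber_le_encard hCA fun x hx => ?_).trans ?_
  · obtain ⟨y, hy, hyx⟩ := hC.surjOn (mem_image_of_mem Φ hx)
    refine ⟨y, hy, ?_⟩
    have := h x hx y (hCA hy) hyx.symm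
    change edist x y ≤ δ
    rw [edist_nndist]
    exact_mod_cast this
  · rw [← hC.injOn.encard_image]
    refine (encard_le_encard (subset_univ _)).trans ?_
    simp

theorem exists_quantization {M ε : ℝ} (hM : 0 ≤ M) (hε : 0 < ε) {m : ℕ} (hm : 2 * M / ε < m) :
    ∃ q : ℂ → Fin m × Fin m, ∀ z w, ‖z‖ ≤ M → ‖w‖ ≤ M → q z = q w → ‖z - w‖ ≤ 2 * ε := by
  have hm0 : 0 < m := by
    have : (0 : ℝ) < m := lt_of_le_of_lt (by positivity) hm
    exact_mod_cast this
  have : NeZero m := ⟨hm0.ne'⟩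
  -- `Fin.ofNat` reduces modulo `m`, harmlessly: `hm` keeps the floors below `m`.
  have key : ∀ x y : ℝ, |x| ≤ M → |y| ≤ M →
      Fin.ofNat m ⌊(x + M) / ε⌋₊ = Fin.ofNat m ⌊(y + M) / ε⌋₊ → |x - y| ≤ ε := by
    intro x y hx hy hxy
    have hlt : ∀ u : ℝ, |u| ≤ M → 0 ≤ (u + M) / ε ∧ ⌊(u + M) / ε⌋₊ < m := fun u hu => by
      have h1 := abs_le.1 hu
      have h2 : 0 ≤ (u + M) / ε := div_nonneg (by linarith) hε.le
      refine ⟨h2, (Nat.floor_lt h2).2 (lt_of_le_of_lt ?_ hm)⟩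
      gcongr
      linarith
    have h3 : ⌊(x + M) / ε⌋₊ = ⌊(y + M) / ε⌋₊ := by
      have := congrArg Fin.val hxy
      simpa [Fin.ofNat, Nat.mod_eq_of_lt (hlt x hx).2, Nat.mod_eq_of_lt (hlt y hy).2] using this
    have hx1 := Nat.floor_le (hlt x hx).1
    have hy1 := Nat.floor_le (hlt y hy).1
    have hx2 := Nat.lt_floor_add_one ((x + M) / ε)
    have hy2 := Nat.lt_floor_add_one ((y + M) / ε)
    rw [h3] at hx1 hx2
    have e1 : |(x + M) / ε - (y + M) / ε| ≤ 1 := abs_le.2 ⟨by linarith, by linarith⟩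
    rw [← sub_div, add_sub_add_right_eq_sub, abs_div, abs_of_pos hε, div_le_one hε] at e1
    exact e1
  refine ⟨fun z => (Fin.ofNat m ⌊(z.re + M) / ε⌋₊, Fin.ofNat m ⌊(z.im + M) / ε⌋₊),
    fun z w hz hw hzw => ?_⟩
  have h1 := key z.re w.re ((abs_re_le_norm z).trans hz) ((abs_re_le_norm w).trans hw)
    (congrArg Prod.fst hzw)
  have h2 := key z.im w.im ((abs_im_le_norm z).trans hz) ((abs_im_le_norm w).trans hw)
    (congrArg Prod.snd hzw)
  have h3 := norm_le_abs_re_add_abs_im (z - w)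
  rw [sub_re, sub_im] at h3
  linarith

theorem exists_forall_norm_le_of_isBigO {u v : ℕ+ → ℝ} (h : u =O[atTop] v) (hv : ∀ j, v j ≠ 0) :
    ∃ C > 0, ∀ j, ‖u j‖ ≤ C * ‖v j‖ := by
  have hle : (cofinite : Filter ℕ+) ≤ atTop := by
    intro s hs
    obtain ⟨a, ha⟩ := mem_atTop_sets.1 hs
    refine (Set.finite_Iio a).subset fun b hb => ?_
    by_contra hba
    exact hb (ha b (not_lt.1 hba))
  obtain ⟨C, hC0, hC⟩ := bound_of_isBigO_cofinite (h.mono hle)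
  exact ⟨C, hC0, fun j => hC (hv j)⟩

/-- The Taylor coefficients at the origin. -/
def taylorCoeff (f : ℂ → ℂ) (k : ℕ) : ℂ := (k.factorial : ℂ)⁻¹ * iteratedDeriv k f 0

theorem hasSum_taylorCoeff {f : ℂ → ℂ} (hf : DifferentiableOn ℂ f (ball 0 1)) {z : ℂ}
    (hz : ‖z‖ < 1) : HasSum (fun k => taylorCoeff f k * z ^ k) (f z) := by
  have := hasSum_taylorSeries_on_ball hf (mem_ball_zero_iff.2 hz)
  simp only [sub_zero, smul_eq_mul] at this
  refine this.congr_fun fun k => ?_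
  rw [taylorCoeff]
  ring

theorem norm_taylorCoeff_mul_pow_le {f : ℂ → ℂ} (hf : DifferentiableOn ℂ f (ball 0 1)) {t M : ℝ}
    (ht0 : 0 < t) (ht1 : t < 1) (hM : ∀ z, ‖z‖ = t → ‖f z‖ ≤ M) (k : ℕ) :
    ‖taylorCoeff f k‖ * t ^ k ≤ M := by
  have h1 := norm_iteratedDeriv_le_of_forall_mem_sphere_norm_le (f := f) (c := 0) k ht0
    ⟨hf.mono (ball_subset_ball ht1.le), hf.continuousOn.mono (by
      rw [closure_ball _ ht0.ne']; exact closedBall_subset_ball ht1)⟩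
    (fun z hz => hM z (mem_sphere_zero_iff_norm.1 hz))
  have hk : (0 : ℝ) < k.factorial := by exact_mod_cast k.factorial_pos
  rw [taylorCoeff, norm_mul, norm_inv, Complex.norm_natCast]
  rw [le_div_iff₀ (by positivity)] at h1
  rw [mul_assoc, inv_mul_le_iff₀ hk]
  exact h1

/-- Cauchy's estimate on `‖z‖ = 1 - η`, where the growth bound is `η⁻²⁸`; since `1 - 2η ≤ (1 - η)²`,
one factor `(1 - η)^k` is left as decay. -/
theorem norm_taylorCoeff_le {f : Hol D} (hf : f ∈ schlichtClass D) {η : ℝ} (h0 : 0 < η)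
    (h1 : 2 * η < 1) (k : ℕ) :
    ‖taylorCoeff f.toFun k * ((1 - 2 * η : ℝ) : ℂ) ^ k‖ ≤ (η ^ 28)⁻¹ * (1 - η) ^ k := by
  have h2 := norm_taylorCoeff_mul_pow_le f.holo (t := 1 - η) (M := (η ^ 28)⁻¹) (by linarith)
    (by linarith) (fun z hz => by
      have := norm_le_inv_pow f.holo hf.1 hf.2.1 hf.2.2 (z := z) (by linarith)
      rwa [hz, sub_sub_cancel] at this) k
  rw [norm_mul, norm_pow, norm_real, Real.norm_of_nonneg (by linarith)]
  calc _ ≤ ‖taylorCoeff f.toFun k‖ * ((1 - η) * (1 - η)) ^ k := by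
        have : 0 ≤ 1 - 2 * η := by linarith
        gcongr
        nlinarith [sq_nonneg η]
    _ = ‖taylorCoeff f.toFun k‖ * (1 - η) ^ k * (1 - η) ^ k := by rw [mul_pow]; ring
    _ ≤ _ := by
        have : 0 ≤ 1 - η := by linarith
        gcongr

theorem supDist_le_of_taylorCoeff {f g : Hol D} (hf : f ∈ schlichtClass D)
    (hg : g ∈ schlichtClass D) {η ε s : ℝ} (h0 : 0 < η) (h1 : 2 * η < 1) (hε : 0 ≤ ε)
    (hs : s ≤ 1 - 2 * η) (n : ℕ)
    (h : ∀ k < n, ‖taylorCoeff f.toFun k * ((1 - 2 * η : ℝ) : ℂ) ^ k -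
      taylorCoeff g.toFun k * ((1 - 2 * η : ℝ) : ℂ) ^ k‖ ≤ ε) :
    supDist s f g ≤ n * ε + 2 * (η ^ 29)⁻¹ * (1 - η) ^ n := by
  have h3 : 0 ≤ 1 - η := by linarith
  have hpos : 0 ≤ n * ε + 2 * (η ^ 29)⁻¹ * (1 - η) ^ n := by positivity
  refine Real.iSup_le (fun z => ?_) hpos
  have hz : ‖(z : ℂ)‖ ≤ 1 - 2 * η := (mem_closedBall_zero_iff.1 z.2).trans hs
  have hz1 : ‖(z : ℂ)‖ < 1 := by linarith
  have hsum := (hasSum_taylorCoeff f.holo hz1).sub (hasSum_taylorCoeff g.holo hz1)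
  have hgeo : HasSum (fun k => 2 * (η ^ 28)⁻¹ * ((1 - η) ^ n * (1 - η) ^ k))
      (2 * (η ^ 29)⁻¹ * (1 - η) ^ n) := by
    have := ((hasSum_geometric_of_lt_one h3 (by linarith)).mul_left ((1 - η) ^ n)).mul_left
      (2 * (η ^ 28)⁻¹)
    have e : 2 * (η ^ 29)⁻¹ * (1 - η) ^ n =
        2 * (η ^ 28)⁻¹ * ((1 - η) ^ n * (1 - (1 - η))⁻¹) := by
      rw [sub_sub_cancel]
      field_simp
    rwa [e]
  have hterm : ∀ k, ‖taylorCoeff f.toFun k * (z : ℂ) ^ k - taylorCoeff g.toFun k * (z : ℂ) ^ k‖ ≤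
      ‖taylorCoeff f.toFun k * ((1 - 2 * η : ℝ) : ℂ) ^ k -
      taylorCoeff g.toFun k * ((1 - 2 * η : ℝ) : ℂ) ^ k‖ := fun k => by
    rw [← sub_mul, ← sub_mul, norm_mul, norm_mul, norm_pow, norm_pow, norm_real,
      Real.norm_of_nonneg (show 0 ≤ 1 - 2 * η by linarith)]
    gcongr
  have htail : ∀ k, ‖taylorCoeff f.toFun (k + n) * (z : ℂ) ^ (k + n) -
      taylorCoeff g.toFun (k + n) * (z : ℂ) ^ (k + n)‖ ≤
      2 * (η ^ 28)⁻¹ * ((1 - η) ^ n * (1 - η) ^ k) := fun k => by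
    refine (hterm _).trans ((norm_sub_le _ _).trans ?_)
    have e1 := norm_taylorCoeff_le hf h0 h1 (k + n)
    have e2 := norm_taylorCoeff_le hg h0 h1 (k + n)
    rw [pow_add (1 - η) k n, mul_comm ((1 - η) ^ k)] at e1 e2
    linarith
  rw [← hsum.tsum_eq, ← hsum.summable.sum_add_tsum_nat_add n]
  refine (norm_add_le _ _).trans (add_le_add ?_ (tsum_of_norm_bounded hgeo htail))
  refine (norm_sum_le_of_le (Finset.range n) fun k hk =>
    (hterm k).trans (h k (Finset.mem_range.1 hk))).trans_eq ?_
  simp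

/-- The bound on `lam j` is a square so that, for `j > J`, one factor `μ^j` makes the series
converge and the other is at most `μ^J`. -/
theorem dist_le_of_supDist_le {f g : Hol D} {κ C μ : ℝ} (hμ0 : 0 < μ) (hμ1 : μ < 1)
    (hκ : 0 ≤ κ)
    (hC : ∀ j, D.lam j ≤ C * (μ ^ (j : ℕ)) ^ 2) (J : ℕ)
    (h : ∀ j : ℕ+, (j : ℕ) ≤ J → supDist (D.r j) f g ≤ κ) :
    dist f g ≤ (∑' j, D.lam j) * κ + C * (∑' j : ℕ+, μ ^ (j : ℕ)) * μ ^ J := by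
  have hC0 : 0 < C := by
    have := (D.lam_pos 1).trans_le (hC 1)
    exact (pos_iff_pos_of_mul_pos this).2 (by positivity)
  have hgeo : Summable fun j : ℕ+ => μ ^ (j : ℕ) :=
    (summable_geometric_of_lt_one hμ0.le hμ1).comp_injective PNat.coe_injective
  have hS : Summable fun j => D.lam j * κ + C * μ ^ (j : ℕ) * μ ^ J :=
    (D.summable_lam.mul_right κ).add ((hgeo.mul_left C).mul_right _)
  have e1 : (∑' j, D.lam j) * κ + C * (∑' j : ℕ+, μ ^ (j : ℕ)) * μ ^ J =
      ∑' j, (D.lam j * κ + C * μ ^ (j : ℕ) * μ ^ J) := by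
    rw [(D.summable_lam.mul_right κ).tsum_add ((hgeo.mul_left C).mul_right _), tsum_mul_right,
      tsum_mul_right, tsum_mul_left]
  rw [e1]
  refine (summable_term f g).tsum_le_tsum (fun j => ?_) hS
  have hl := D.lam_pos j
  rcases le_or_gt (j : ℕ) J with hj | hj
  · have h2 : D.lam j * min 1 (supDist (D.r j) f g) ≤ D.lam j * κ :=
      mul_le_mul_of_nonneg_left ((min_le_right _ _).trans (h j hj)) hl.le
    have : 0 ≤ C * μ ^ (j : ℕ) * μ ^ J := by positivity
    linarith
  · have h2 : D.lam j * min 1 (supDist (D.r j) f g) ≤ D.lam j * 1 :=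
      mul_le_mul_of_nonneg_left (min_le_left _ _) hl.le
    have h3 : μ ^ (j : ℕ) ≤ μ ^ J := pow_le_pow_of_le_one hμ0.le hμ1.le hj.le
    have h4 : C * (μ ^ (j : ℕ)) ^ 2 ≤ C * μ ^ (j : ℕ) * μ ^ J := by
      rw [sq, ← mul_assoc]; gcongr
    have h5 := hC j
    have : 0 ≤ D.lam j * κ := by positivity
    linarith

theorem coveringNumber_schlichtClass_le {C μ η ε : ℝ} {δ : ℝ≥0} {J n m : ℕ} (hμ0 : 0 < μ)
    (hμ1 : μ < 1) (hC : ∀ j, D.lam j ≤ C * (μ ^ (j : ℕ)) ^ 2) (h0 : 0 < η) (h1 : 2 * η < 1)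
    (hε : 0 < ε) (hJ : ∀ j : ℕ+, (j : ℕ) ≤ J → D.r j ≤ 1 - 2 * η)
    (hm : 2 * (η ^ 28)⁻¹ / ε < m)
    (hδ : (∑' j, D.lam j) * (n * (2 * ε) + 2 * (η ^ 29)⁻¹ * (1 - η) ^ n) +
      C * (∑' j : ℕ+, μ ^ (j : ℕ)) * μ ^ J ≤ δ) :
    coveringNumber δ (schlichtClass D) ≤ ((m ^ (2 * n) : ℕ) : ℕ∞) := by
  obtain ⟨q, hq⟩ := exists_quantization (by positivity : 0 ≤ (η ^ 28)⁻¹) hε hm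
  have h3 : 0 ≤ 1 - η := by linarith
  have hcard : Fintype.card (Fin n → Fin m × Fin m) = m ^ (2 * n) := by
    simp [← sq, ← pow_mul]
  rw [← hcard]
  refine coveringNumber_le_card (fun f (k : Fin n) =>
    q (taylorCoeff f.toFun k * ((1 - 2 * η : ℝ) : ℂ) ^ (k : ℕ))) fun f hf g hg hfg => ?_
  have hcoef : ∀ {f : Hol D}, f ∈ schlichtClass D → ∀ k,
      ‖taylorCoeff f.toFun k * ((1 - 2 * η : ℝ) : ℂ) ^ k‖ ≤ (η ^ 28)⁻¹ := fun hf k =>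
    (norm_taylorCoeff_le hf h0 h1 k).trans (mul_le_of_le_one_right (by positivity)
      (pow_le_one₀ h3 (by linarith)))
  refine (dist_le_of_supDist_le hμ0 hμ1 (by positivity) hC J fun j hj => ?_).trans hδ
  exact supDist_le_of_taylorCoeff hf hg h0 h1 (by positivity) (hJ j hj) n fun k hk =>
    hq _ _ (hcoef hf k) (hcoef hg k) (congrFun hfg ⟨k, hk⟩)

theorem eventually_mul_rpow_mul_exp_neg_le (a s : ℝ) {b : ℝ} (hb : 0 < b) :
    ∀ᶠ L : ℝ in atTop, a * L ^ s * Real.exp (-L) ≤ b := by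
  have h := (tendsto_rpow_mul_exp_neg_mul_atTop_nhds_zero s 1 one_pos).const_mul a
  rw [mul_zero] at h
  filter_upwards [h.eventually (gt_mem_nhds hb)] with L hL
  rw [neg_one_mul, ← mul_assoc] at hL
  exact hL.le

theorem exists_coveringNumber_schlichtClass_le {l α : ℝ} (hl0 : 0 < l) (hl1 : l < 1) (hα : 0 < α)
    (hlam : D.lam =O[atTop] fun j : ℕ+ => l ^ (j : ℕ))
    (hr : (fun j : ℕ+ => ((j : ℕ) : ℝ) ^ (-α)) =O[atTop] (fun j : ℕ+ => 1 - D.r j)) :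
    ∃ K : ℝ, ∀ᶠ L : ℝ in atTop, ∀ δ : ℝ≥0, (δ : ℝ) = Real.exp (-L) → ∃ N : ℕ,
      coveringNumber δ (schlichtClass D) ≤ (N : ℕ∞) ∧ Real.log N ≤ K * L ^ (2 + α) := by
  obtain ⟨C₁, hC₁0, hC₁⟩ := exists_forall_norm_le_of_isBigO hlam fun j => (pow_pos hl0 _).ne'
  obtain ⟨C₂, hC₂0, hC₂⟩ := exists_forall_norm_le_of_isBigO hr fun j => by
    have := D.r_lt_one j
    linarith
  set μ := √l with hμ
  have hμ0 : 0 < μ := Real.sqrt_pos.2 hl0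
  have hμ1 : μ < 1 := by rw [hμ, Real.sqrt_lt' one_pos]; simpa using hl1
  have hC : ∀ j, D.lam j ≤ C₁ * (μ ^ (j : ℕ)) ^ 2 := fun j => by
    have h1 := hC₁ j
    rw [Real.norm_of_nonneg (D.lam_pos j).le, Real.norm_of_nonneg (by positivity)] at h1
    rwa [← pow_mul, mul_comm (j : ℕ), pow_mul, hμ, Real.sq_sqrt hl0.le]
  have hlogμ : Real.log μ < 0 := Real.log_neg hμ0 hμ1
  -- `A` gives `μ^J ≤ e^(-2L)` for `J ≥ A L`; `c` gives `2η ≤ 1 - r j` for `j ≤ J`; `κ` gives `η n ≥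
  -- 2L`, hence `(1 - η)^n ≤ e^(-2L)`.
  set A := 2 / (-Real.log μ) with hA
  have hA0 : 0 < A := div_pos two_pos (by linarith)
  set c := (A + 1) ^ (-α) / (2 * C₂) with hc
  have hc0 : 0 < c := by positivity
  set κ := 2 / c with hκ
  have hκ0 : 0 < κ := by positivity
  set Λ := ∑' j, D.lam j with hΛ
  have hΛ0 : 0 ≤ Λ := tsum_nonneg fun j => (D.lam_pos j).le
  set S := ∑' j : ℕ+, μ ^ (j : ℕ) with hS
  refine ⟨8 * (κ + 1), ?_⟩
  -- Each error is `e^(-2L)` times a power of `L`. One factor `e^(-L)` absorbs the power, so each of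
  -- the three contributions to the distance is at most `δ / 3`. The last condition is for the grid
  -- size `m`.
  filter_upwards [eventually_ge_atTop 1,
    eventually_mul_rpow_mul_exp_neg_le (Λ * 4 * (κ + 1)) (1 + α) (b := 1 / 3) (by norm_num),
    eventually_mul_rpow_mul_exp_neg_le (Λ * 2 * (c ^ 29)⁻¹) (α * 29) (b := 1 / 3) (by norm_num),
    eventually_mul_rpow_mul_exp_neg_le (C₁ * S) 0 (b := 1 / 3) (by norm_num),
    eventually_mul_rpow_mul_exp_neg_le (2 * (c ^ 28)⁻¹) (α * 28) (b := 1 / 2) (by norm_num)]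
    with L hL ha hb hcS hm δ hδ
  have hL0 : 0 < L := by linarith
  set J := ⌈A * L⌉₊ with hJ
  set η := c * L ^ (-α) with hη
  have hη0 : 0 < η := by positivity
  have hηinv : ∀ k : ℕ, (η ^ k)⁻¹ = (c ^ k)⁻¹ * L ^ (α * k) := fun k => by
    rw [hη, mul_pow, mul_inv, Real.rpow_neg hL0.le, inv_pow, inv_inv, Real.rpow_mul hL0.le,
      Real.rpow_natCast]
  have hJle : (J : ℝ) ≤ (A + 1) * L := by
    have := Nat.ceil_lt_add_one (mul_pos hA0 hL0).le
    rw [← hJ] at this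
    linarith
  have hJ1 : 1 ≤ J := Nat.one_le_ceil_iff.2 (mul_pos hA0 hL0)
  have hrJ : ∀ j : ℕ+, (j : ℕ) ≤ J → D.r j ≤ 1 - 2 * η := fun j hj => by
    have h1 := hC₂ j
    have h2 := D.r_lt_one j
    have hj0 : (0 : ℝ) < (j : ℕ) := by exact_mod_cast j.pos
    rw [Real.norm_of_nonneg (by positivity), Real.norm_of_nonneg (by linarith)] at h1
    have h3 : ((A + 1) * L) ^ (-α) ≤ ((j : ℕ) : ℝ) ^ (-α) :=
      Real.rpow_le_rpow_of_nonpos hj0 (le_trans (by exact_mod_cast hj) hJle) (by linarith)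
    have h4 : C₂ * (2 * η) = ((A + 1) * L) ^ (-α) := by
      rw [hη, hc, Real.mul_rpow (by positivity) hL0.le]
      field_simp
    have h5 := le_of_mul_le_mul_left (h4.trans_le (h3.trans h1)) hC₂0
    linarith
  have hη1 : 2 * η < 1 := by
    have := hrJ 1 (by simpa using hJ1)
    have := D.r_pos 1
    linarith
  set n := ⌈κ * L ^ (1 + α)⌉₊ with hn
  have hLα : 1 ≤ L ^ (1 + α) := Real.one_le_rpow hL (by linarith)
  have hnle : (n : ℝ) ≤ (κ + 1) * L ^ (1 + α) := by
    have := Nat.ceil_lt_add_one (a := κ * L ^ (1 + α)) (by positivity)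
    rw [← hn] at this
    linarith
  have hηn : 2 * L ≤ η * n := by
    have h1 : κ * L ^ (1 + α) ≤ n := Nat.le_ceil _
    calc 2 * L = η * (κ * L ^ (1 + α)) := by
          rw [hη, hκ, Real.rpow_neg hL0.le, Real.rpow_add hL0, Real.rpow_one]
          have : L ^ α ≠ 0 := by positivity
          field_simp
      _ ≤ _ := by gcongr
  have hexp2 : Real.exp (-(2 * L)) = Real.exp (-L) * Real.exp (-L) := by
    rw [← Real.exp_add]; ring_nf
  have hpow : (1 - η) ^ n ≤ Real.exp (-L) * Real.exp (-L) := by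
    rw [← hexp2]
    calc (1 - η) ^ n ≤ Real.exp (-η) ^ n := by
          have := Real.one_sub_le_exp_neg η
          have : 0 ≤ 1 - η := by linarith
          gcongr
      _ = Real.exp (-(η * n)) := by rw [← Real.exp_nat_mul]; ring_nf
      _ ≤ _ := Real.exp_le_exp.2 (by linarith)
  have hμJ : μ ^ J ≤ Real.exp (-L) * Real.exp (-L) := by
    rw [← hexp2, ← Real.exp_log (pow_pos hμ0 J), Real.log_pow]
    refine Real.exp_le_exp.2 ?_
    have h1 : A * L ≤ J := Nat.le_ceil _
    have h2 : A * L * Real.log μ = -(2 * L) := by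
      have := hlogμ.ne
      rw [hA]; field_simp
    rw [← h2]
    exact mul_le_mul_of_nonpos_right h1 hlogμ.le
  set m := ⌈Real.exp (3 * L)⌉₊ with hmdef
  set e := Real.exp (-L) with he
  have he0 : 0 < e := Real.exp_pos _
  refine ⟨m ^ (2 * n), coveringNumber_schlichtClass_le (ε := e * e) hμ0 hμ1 hC hη0 hη1
    (by positivity) hrJ ?_ ?_, ?_⟩
  · refine lt_of_lt_of_le ?_ (Nat.le_ceil _)
    have h3 : Real.exp (3 * L) = (e * e * e)⁻¹ := by
      rw [he, ← Real.exp_add, ← Real.exp_add, ← Real.exp_neg]; ring_nf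
    have h4 := hηinv 28
    push_cast at h4
    rw [h4, h3, div_lt_iff₀ (by positivity)]
    have h5 : (e * e * e)⁻¹ * (e * e) = 1 / e := by field_simp
    rw [h5, lt_div_iff₀ he0]
    linarith
  · have h4 := hηinv 29
    push_cast at h4
    rw [hδ, h4]
    have t1 : Λ * (n * (2 * (e * e))) ≤ 1 / 3 * e := by
      calc Λ * (n * (2 * (e * e))) ≤ Λ * ((κ + 1) * L ^ (1 + α) * (2 * (e * e))) := by gcongr
        _ ≤ Λ * 4 * (κ + 1) * L ^ (1 + α) * e * e := by
          have : 0 ≤ Λ * (κ + 1) * L ^ (1 + α) * e * e := by positivity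
          linarith
        _ ≤ _ := by gcongr
    have t2 : Λ * (2 * ((c ^ 29)⁻¹ * L ^ (α * 29)) * (1 - η) ^ n) ≤ 1 / 3 * e := by
      calc _ ≤ Λ * (2 * ((c ^ 29)⁻¹ * L ^ (α * 29)) * (e * e)) := by gcongr
        _ = Λ * 2 * (c ^ 29)⁻¹ * L ^ (α * 29) * e * e := by ring
        _ ≤ _ := by gcongr
    have t3 : C₁ * S * μ ^ J ≤ 1 / 3 * e := by
      have hS0 : 0 ≤ S := tsum_nonneg fun j => by positivity
      calc _ ≤ C₁ * S * (e * e) := by gcongr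
        _ = C₁ * S * L ^ (0 : ℝ) * e * e := by rw [Real.rpow_zero]; ring
        _ ≤ _ := by gcongr
    rw [mul_add]
    linarith
  · have h1 : 1 ≤ Real.exp (3 * L) := Real.one_le_exp (by linarith)
    have hm0 : 0 < m := Nat.ceil_pos.2 (Real.exp_pos _)
    have h2 : (m : ℝ) ≤ Real.exp (4 * L) := by
      have h3 := Nat.ceil_lt_add_one (Real.exp_pos (3 * L)).le
      have h4 : 2 ≤ Real.exp L := by
        have := Real.add_one_le_exp L
        linarith
      have h5 : Real.exp (4 * L) = Real.exp (3 * L) * Real.exp L := by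
        rw [← Real.exp_add]; ring_nf
      rw [h5]
      nlinarith
    have h6 : Real.log m ≤ 4 * L := by
      rw [Real.log_le_iff_le_exp (by exact_mod_cast hm0)]
      exact h2
    rw [Nat.cast_pow, Real.log_pow]
    push_cast
    calc 2 * (n : ℝ) * Real.log m ≤ 2 * ((κ + 1) * L ^ (1 + α)) * (4 * L) := by
          have : 0 ≤ Real.log m := Real.log_natCast_nonneg m
          gcongr
      _ = 8 * (κ + 1) * L ^ (2 + α) := by
          rw [show 2 + α = 1 + α + 1 by ring, Real.rpow_add_one hL0.ne' (1 + α)]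
          ring

/-! ### Lower bound: a separated family of polynomials -/

theorem norm_pow_sub_pow_le_mul {z w : ℂ} (hz : ‖z‖ ≤ 1) (hw : ‖w‖ ≤ 1) (k : ℕ) :
    ‖z ^ k - w ^ k‖ ≤ k * ‖z - w‖ := by
  rw [← geom_sum₂_mul, norm_mul]
  gcongr
  refine (norm_sum_le_of_le (Finset.range k) (f := fun i => z ^ i * w ^ (k - 1 - i))
    (n := fun _ => (1 : ℝ)) fun i _ => ?_).trans_eq (by simp)
  rw [norm_mul, norm_pow, norm_pow]
  exact mul_le_one₀ (pow_le_one₀ (norm_nonneg z) hz) (by positivity)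
    (pow_le_one₀ (norm_nonneg w) hw)

/-- The function `z + ∑ k, c k * z ^ (k + 2)` on the unit disk. -/
def perturbId (D : MetricData) {n : ℕ} (c : Fin n → ℝ) : Hol D where
  toFun := (ball (0 : ℂ) 1).indicator fun z => z + ∑ k, (c k : ℂ) * z ^ ((k : ℕ) + 2)
  holo := by
    have : DifferentiableOn ℂ (fun z : ℂ => z + ∑ k, (c k : ℂ) * z ^ ((k : ℕ) + 2)) (ball 0 1) := by
      fun_prop
    exact this.congr fun z hz => indicator_of_mem hz _
  zero_outside z hz := indicator_of_notMem hz _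

theorem perturbId_apply {n : ℕ} (c : Fin n → ℝ) {z : ℂ} (hz : ‖z‖ < 1) :
    (perturbId D c).toFun z = z + ∑ k, (c k : ℂ) * z ^ ((k : ℕ) + 2) :=
  indicator_of_mem (f := fun z => z + ∑ k, (c k : ℂ) * z ^ ((k : ℕ) + 2))
    (mem_ball_zero_iff.2 hz)

/-- The perturbation of the identity has Lipschitz constant less than `1` on the disk, so the sum is
injective. -/
theorem perturbId_mem_schlichtClass {n : ℕ} {c : Fin n → ℝ}
    (hc : ∑ k, |c k| * ((k : ℕ) + 2) < 1) : perturbId D c ∈ schlichtClass D := by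
  refine ⟨fun z hz w hw hzw => ?_, ?_, ?_⟩
  · rw [mem_ball_zero_iff] at hz hw
    rw [perturbId_apply c hz, perturbId_apply c hw] at hzw
    have h1 : z - w = -∑ k, (c k : ℂ) * (z ^ ((k : ℕ) + 2) - w ^ ((k : ℕ) + 2)) := by
      simp only [mul_sub, Finset.sum_sub_distrib]
      linear_combination hzw
    have h2 : ‖z - w‖ ≤ (∑ k, |c k| * ((k : ℕ) + 2)) * ‖z - w‖ := by
      conv_lhs => rw [h1, norm_neg]
      rw [Finset.sum_mul]
      refine norm_sum_le_of_le _ fun k _ => ?_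
      rw [norm_mul, norm_real, Real.norm_eq_abs, mul_assoc]
      have := norm_pow_sub_pow_le_mul hz.le hw.le ((k : ℕ) + 2)
      push_cast at this
      gcongr
    by_contra hne
    have h3 : 0 < ‖z - w‖ := norm_pos_iff.2 (sub_ne_zero.2 hne)
    nlinarith
  · rw [perturbId_apply c (by simp)]
    simp
  · have h1 : HasDerivAt (fun z : ℂ => z + ∑ k, (c k : ℂ) * z ^ ((k : ℕ) + 2)) 1 0 := by
      have := (hasDerivAt_id (0 : ℂ)).add (HasDerivAt.fun_sum (u := Finset.univ)
        fun (k : Fin n) _ => (hasDerivAt_pow ((k : ℕ) + 2) (0 : ℂ)).const_mul (c k : ℂ))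
      refine this.congr_deriv ?_
      simp
    refine (h1.congr_of_eventuallyEq ?_).deriv
    filter_upwards [isOpen_ball.mem_nhds (mem_ball_self (x := (0 : ℂ)) one_pos)] with z hz
    exact perturbId_apply c (mem_ball_zero_iff.1 hz)

/-- By Parseval, the sum of the squared coefficients is the mean of `‖p‖ ^ 2` over the unit circle.
-/
theorem norm_coeff_le_of_norm_eval_le (p : Polynomial ℂ) {M : ℝ}
    (hM : ∀ z : ℂ, ‖z‖ = 1 → ‖p.eval z‖ ≤ M) (k : ℕ) : ‖p.coeff k‖ ≤ M := by
  have hM0 : 0 ≤ M := (norm_nonneg _).trans (hM 1 norm_one)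
  by_cases hk : k ∈ p.support
  · refine le_of_sq_le_sq ?_ hM0
    refine (Finset.single_le_sum (f := fun i => ‖p.coeff i‖ ^ 2) (fun i _ => by positivity)
      hk).trans ?_
    rw [p.sum_sq_norm_coeff_eq_circleAverage]
    refine Real.circleAverage_mono_on_of_le_circle ?_ fun z hz => ?_
    · exact ContinuousOn.circleIntegrable' (by fun_prop)
    · rw [abs_one] at hz
      have := hM z (mem_sphere_zero_iff_norm.1 hz)
      gcongr
  · rw [Polynomial.notMem_support_iff.1 hk, norm_zero]
    exact hM0

theorem mul_pow_le_supDist_perturbId {n : ℕ} (a b : Fin n → ℝ) {s : ℝ} (hs0 : 0 < s) (hs1 : s < 1)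
    (k : Fin n) : |a k - b k| * s ^ ((k : ℕ) + 2) ≤
      supDist s (perturbId D a) (perturbId D b) := by
  -- The difference of the two functions at `s z`, so that the circle of radius `s` becomes the unit
  -- circle.
  set p : Polynomial ℂ := ∑ i : Fin n,
    Polynomial.monomial ((i : ℕ) + 2) (((a i - b i) * s ^ ((i : ℕ) + 2) : ℝ) : ℂ) with hp
  have hcoeff : p.coeff ((k : ℕ) + 2) = (((a k - b k) * s ^ ((k : ℕ) + 2) : ℝ) : ℂ) := by
    rw [hp, Polynomial.finsetSum_coeff, Finset.sum_eq_single k]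
    · simp
    · intro i _ hi
      rw [Polynomial.coeff_monomial, if_neg]
      exact fun h => hi (Fin.ext (Nat.add_right_cancel h))
    · simp
  have h := norm_coeff_le_of_norm_eval_le p
    (M := supDist s (perturbId D a) (perturbId D b)) (fun z hz => ?_) ((k : ℕ) + 2)
  · rw [hcoeff, norm_real, Real.norm_eq_abs, abs_mul, abs_of_pos (pow_pos hs0 _)] at h
    exact h
  · have hsz : ‖(s : ℂ) * z‖ = s := by
      rw [norm_mul, norm_real, Real.norm_of_nonneg hs0.le, hz, mul_one]
    have h1 := le_supDist hs1 (perturbId D a) (perturbId D b) hsz.le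
    rw [perturbId_apply _ (hsz.trans_lt hs1), perturbId_apply _ (hsz.trans_lt hs1)] at h1
    refine le_trans (le_of_eq ?_) h1
    congr 1
    rw [add_sub_add_left_eq_sub, ← Finset.sum_sub_distrib, hp, Polynomial.eval_finsetSum]
    refine Finset.sum_congr rfl fun i _ => ?_
    rw [Polynomial.eval_monomial]
    push_cast
    ring

theorem mul_le_dist_of_le_supDist {f g : Hol D} {κ : ℝ} (hκ : κ ≤ 1) (j : ℕ+)
    (h : κ ≤ supDist (D.r j) f g) : D.lam j * κ ≤ dist f g :=
  (mul_le_mul_of_nonneg_left (le_min hκ h) (D.lam_pos j).le).trans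
    ((summable_term f g).le_tsum j fun i _ => term_nonneg f g i)

theorem pow_le_coveringNumber_schlichtClass {n m : ℕ} {h : ℝ} {δ : ℝ≥0} (h0 : 0 < h) (h1 : h ≤ 1)
    (hsum : n * ((n + 1) * (m * h)) < 1)
    (hδ : 2 * δ < D.lam 1 * (h * D.r 1 ^ (n + 1))) :
    ((m ^ n : ℕ) : ℕ∞) ≤ coveringNumber δ (schlichtClass D) := by
  have hr0 := D.r_pos 1
  have hr1 := D.r_lt_one 1
  set Ψ : (Fin n → Fin m) → Hol D := fun a => perturbId D fun k => ((a k : ℕ) : ℝ) * h with hΨ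
  have hmem : ∀ a, Ψ a ∈ schlichtClass D := fun a => perturbId_mem_schlichtClass <| by
    refine lt_of_le_of_lt ?_ hsum
    refine (Finset.sum_le_card_nsmul _ _ ((n + 1) * (m * h)) fun k _ => ?_).trans_eq (by simp)
    rw [abs_of_nonneg (by positivity), mul_comm]
    have e1 : ((k : ℕ) : ℝ) + 2 ≤ n + 1 := by
      have := k.2
      have : (k : ℕ) + 2 ≤ n + 1 := by omega
      exact_mod_cast this
    have e2 : ((a k : ℕ) : ℝ) ≤ m := by exact_mod_cast (a k).2.le
    gcongr
  have hsep : ∀ a b, a ≠ b → 2 * (δ : ℝ) < dist (Ψ a) (Ψ b) := fun a b hab => by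
    obtain ⟨k, hk⟩ := Function.ne_iff.1 hab
    refine hδ.trans_le (mul_le_dist_of_le_supDist (mul_le_one₀ h1 (by positivity)
      (pow_le_one₀ hr0.le hr1.le)) 1 ?_)
    refine le_trans ?_ (mul_pow_le_supDist_perturbId (fun k => ((a k : ℕ) : ℝ) * h)
      (fun k => ((b k : ℕ) : ℝ) * h) hr0 hr1 k)
    have e1 : 1 ≤ |((a k : ℕ) : ℝ) - ((b k : ℕ) : ℝ)| := by
      have : ((a k : ℕ) : ℤ) - ((b k : ℕ) : ℤ) ≠ 0 := by
        rw [sub_ne_zero]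
        exact_mod_cast fun h => hk (Fin.ext h)
      exact_mod_cast Int.one_le_abs this
    have e2 : D.r 1 ^ (n + 1) ≤ D.r 1 ^ ((k : ℕ) + 2) :=
      pow_le_pow_of_le_one hr0.le hr1.le (by have := k.2; omega)
    rw [← sub_mul, abs_mul, abs_of_pos h0]
    calc h * D.r 1 ^ (n + 1) = 1 * h * D.r 1 ^ (n + 1) := by ring
      _ ≤ _ := by gcongr
  have hinj : Function.Injective Ψ := fun a b hab => by
    by_contra hne
    have := hsep a b hne
    rw [hab, dist_self] at this
    have := δ.2
    linarith
  -- Separation by more than `2δ` prevents a ball of radius `δ` from containing two members of the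
  -- family.
  have hIs : IsSeparated ((2 * δ : ℝ≥0) : ℝ≥0∞) (range Ψ) := by
    rintro _ ⟨a, rfl⟩ _ ⟨b, rfl⟩ hab
    have := hsep a b fun h => hab (by rw [h])
    change _ < edist (Ψ a) (Ψ b)
    rw [edist_nndist]
    exact_mod_cast this
  have hcard : (range Ψ).encard = ((m ^ n : ℕ) : ℕ∞) := by
    rw [← image_univ, hinj.encard_image, encard_univ]
    simp
  rw [← hcard]
  exact (hIs.encard_le_packingNumber (range_subset_iff.2 hmem)).trans
    ((packingNumber_two_mul_le_externalCoveringNumber δ _).trans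
      (externalCoveringNumber_le_coveringNumber δ _))

theorem exists_le_coveringNumber_schlichtClass (D : MetricData) :
    ∃ c : ℝ, 0 < c ∧ ∀ᶠ L : ℝ in atTop, ∀ δ : ℝ≥0, (δ : ℝ) = Real.exp (-L) → ∃ N : ℕ, 0 < N ∧
      (N : ℕ∞) ≤ coveringNumber δ (schlichtClass D) ∧ c * L ^ 2 ≤ Real.log N := by
  have hr0 := D.r_pos 1
  have hr1 := D.r_lt_one 1
  have hlog : Real.log (D.r 1) < 0 := Real.log_neg hr0 hr1
  -- Chosen so that `n ≤ B L` gives `r 1 ^ n ≥ e^(-L/4)`.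
  set B := 1 / (4 * (-Real.log (D.r 1))) with hB
  have hB0 : 0 < B := by
    have : 0 < -Real.log (D.r 1) := by linarith
    positivity
  refine ⟨B / 16, by positivity, ?_⟩
  have hlim : Tendsto (fun L : ℝ => L / 4) atTop atTop := tendsto_id.atTop_div_const (by norm_num)
  filter_upwards [eventually_ge_atTop (8 * Real.log 2), eventually_ge_atTop (2 / B),
    eventually_ge_atTop 1,
    hlim.eventually (eventually_mul_rpow_mul_exp_neg_le (B * 4 * (B * 4 + 4)) 2
      (b := 1 / 2) (by norm_num)),
    hlim.eventually (eventually_mul_rpow_mul_exp_neg_le (2 / (D.lam 1 * D.r 1)) 0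
      (b := 1 / 2) (by norm_num))] with L hL2 hLB hL1 ha hb δ hδ
  -- With `δ = e⁴` and mesh `e²`, the choice `m ≤ 1 / e` keeps coefficients below `e`, which beats
  -- the factor `n (n + 1)`. Separation needs `2 e⁴ < lam 1 * e² * r 1 ^ (n + 1)`, where `r 1 ^ n ≥
  -- e` and `2e < lam 1 * r 1`.
  set e := Real.exp (-(L / 4)) with he
  have he0 : 0 < e := Real.exp_pos _
  have he1 : e ≤ 1 := Real.exp_le_one_iff.2 (by linarith)
  set n := ⌊B * L⌋₊ with hn
  set m := ⌊Real.exp (L / 4)⌋₊ with hm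
  have hn1 : (n : ℝ) ≤ B * L := Nat.floor_le (by positivity)
  have hn2 : B * L / 2 ≤ n := by
    have := Nat.lt_floor_add_one (B * L)
    rw [← hn] at this
    rw [div_le_iff₀ hB0] at hLB
    linarith
  have hme : (m : ℝ) * e ≤ 1 := by
    have := Nat.floor_le (Real.exp_pos (L / 4)).le
    calc (m : ℝ) * e ≤ Real.exp (L / 4) * e := by gcongr
      _ = 1 := by rw [he, ← Real.exp_add, add_neg_cancel, Real.exp_zero]
  have hexp : 1 ≤ Real.exp (L / 4) := Real.one_le_exp (by linarith)
  have hm0 : 0 < m := Nat.floor_pos.2 hexp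
  have hm2 : Real.exp (L / 4) / 2 ≤ m := by
    have h1 := Nat.lt_floor_add_one (Real.exp (L / 4))
    have h2 : (1 : ℝ) ≤ m := by exact_mod_cast hm0
    rw [← hm] at h1
    linarith
  have hδe : (δ : ℝ) = e ^ 4 := by
    rw [hδ, he, ← Real.exp_nat_mul]; congr 1; push_cast; ring
  refine ⟨m ^ n, by positivity, pow_le_coveringNumber_schlichtClass (h := e * e) (by positivity)
    (mul_le_one₀ he1 he0.le he1) ?_ ?_, ?_⟩
  · calc (n : ℝ) * ((n + 1) * (m * (e * e))) = n * (n + 1) * (m * e) * e := by ring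
      _ ≤ (B * L) * (B * L + L) * 1 * e := by gcongr
      _ = B * 4 * (B * 4 + 4) * (L / 4) ^ (2 : ℝ) * e := by
        rw [Real.rpow_two]
        ring
      _ ≤ 1 / 2 := ha
      _ < 1 := by norm_num
  · have h1 : e ≤ D.r 1 ^ n := by
      rw [← Real.exp_log (pow_pos hr0 n), Real.log_pow]
      refine Real.exp_le_exp.2 ?_
      have h2 : B * L * Real.log (D.r 1) = -(L / 4) := by
        have := hlog.ne
        rw [hB]; field_simp
      rw [← h2]
      exact mul_le_mul_of_nonpos_right hn1 hlog.le
    have hl := D.lam_pos 1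
    have h3 : 2 * e < D.lam 1 * D.r 1 := by
      rw [Real.rpow_zero, mul_one, div_mul_eq_mul_div, div_le_iff₀ (by positivity)] at hb
      have : 0 < D.lam 1 * D.r 1 := by positivity
      linarith
    rw [hδe]
    calc 2 * e ^ 4 = e ^ 3 * (2 * e) := by ring
      _ < e ^ 3 * (D.lam 1 * D.r 1) := by gcongr
      _ = D.lam 1 * (e * e * (e * D.r 1)) := by ring
      _ ≤ D.lam 1 * (e * e * (D.r 1 ^ n * D.r 1)) := by gcongr
      _ = _ := by rw [pow_succ]
  · have h1 : L / 8 ≤ Real.log m := by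
      have h2 : L / 4 - Real.log 2 ≤ Real.log m := by
        rw [← Real.log_exp (L / 4), ← Real.log_div (Real.exp_pos _).ne' two_ne_zero]
        exact Real.log_le_log (by positivity) hm2
      linarith
    rw [Nat.cast_pow, Real.log_pow]
    calc B / 16 * L ^ 2 = B * L / 2 * (L / 8) := by ring
      _ ≤ _ := by gcongr

/-! ### Passage to `δ → 0⁺` and conclusion -/

theorem tendsto_log_one_div_nhdsGT_zero :
    Tendsto (fun δ : ℝ≥0 => Real.log (1 / (δ : ℝ))) (𝓝[>] 0) atTop := by
  have h1 : Tendsto (fun δ : ℝ≥0 => (δ : ℝ)) (𝓝[>] 0) (𝓝[>] 0) := by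
    refine tendsto_nhdsWithin_iff.2 ⟨?_, ?_⟩
    · exact (NNReal.continuous_coe.tendsto' 0 0 rfl).mono_left nhdsWithin_le_nhds
    · filter_upwards [self_mem_nhdsWithin] with δ hδ
      exact NNReal.coe_pos.2 hδ
  refine (Real.tendsto_log_atTop.comp (tendsto_inv_nhdsGT_zero.comp h1)).congr fun δ => ?_
  simp

theorem eventually_nhdsGT_zero_of_eventually_exp_neg {P : ℝ → ℝ≥0 → Prop}
    (h : ∀ᶠ L : ℝ in atTop, ∀ δ : ℝ≥0, (δ : ℝ) = Real.exp (-L) → P L δ) :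
    ∀ᶠ δ : ℝ≥0 in 𝓝[>] 0, P (Real.log (1 / (δ : ℝ))) δ := by
  filter_upwards [tendsto_log_one_div_nhdsGT_zero.eventually h, self_mem_nhdsWithin] with δ hδ hδ0
  refine hδ δ ?_
  rw [one_div, Real.log_inv, neg_neg, Real.exp_log (NNReal.coe_pos.2 hδ0)]

theorem eventually_logCovering_schlichtClass_bounds {D : MetricData} {l α : ℝ} (hl0 : 0 < l)
    (hl1 : l < 1) (hα : 0 < α) (hlam : D.lam =O[atTop] fun j : ℕ+ => l ^ (j : ℕ))
    (hr : (fun j : ℕ+ => ((j : ℕ) : ℝ) ^ (-α)) =O[atTop] (fun j : ℕ+ => 1 - D.r j)) :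
    ∃ c K : ℝ, 0 < c ∧ ∀ᶠ δ : ℝ≥0 in 𝓝[>] 0, ∃ M : ℕ, 0 < M ∧
      coveringNumber δ (schlichtClass D) = (M : ℕ∞) ∧
      c * Real.log (1 / (δ : ℝ)) ^ 2 ≤ Real.log M ∧
      Real.log M ≤ K * Real.log (1 / (δ : ℝ)) ^ (2 + α) := by
  obtain ⟨K, hK⟩ := exists_coveringNumber_schlichtClass_le hl0 hl1 hα hlam hr
  obtain ⟨c, hc0, hc⟩ := exists_le_coveringNumber_schlichtClass D
  refine ⟨c, K, hc0, ?_⟩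
  filter_upwards [eventually_nhdsGT_zero_of_eventually_exp_neg hK,
    eventually_nhdsGT_zero_of_eventually_exp_neg hc] with δ ⟨N, hN, hlN⟩ ⟨N', hN'0, hN', hlN'⟩
  obtain ⟨M, hM⟩ := ENat.ne_top_iff_exists.1 (hN.trans_lt (ENat.natCast_lt_top N)).ne
  rw [← hM, Nat.cast_le] at hN hN'
  have hM0 := hN'0.trans_le hN'
  refine ⟨M, hM0, hM.symm, hlN'.trans ?_, le_trans ?_ hlN⟩
  · exact Real.log_le_log (by exact_mod_cast hN'0) (by exact_mod_cast hN')
  · exact Real.log_le_log (by exact_mod_cast hM0) (by exact_mod_cast hN)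

end Schlicht

end

theorem theorem1 (D : Schlicht.MetricData) (l α : ℝ) (hl0 : 0 < l) (hl1 : l < 1) (hα : 0 < α)
    (hlam : D.lam =Θ[atTop] fun j : ℕ+ => l ^ (j : ℕ))
    (hr : (fun j : ℕ+ => 1 - D.r j) =Θ[atTop] fun j : ℕ+ => ((j : ℕ) : ℝ) ^ (-α)) :
    (∀ δ : ℝ≥0, 0 < δ → Metric.coveringNumber δ (Schlicht.schlichtClass D) ≠ ⊤) ∧
    (fun δ : ℝ≥0 => Real.log (1 / (δ : ℝ)) ^ 2) =O[𝓝[>] 0]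
      Schlicht.logCovering (Schlicht.schlichtClass D) ∧
    Schlicht.logCovering (Schlicht.schlichtClass D) =O[𝓝[>] 0]
      (fun δ : ℝ≥0 => Real.log (1 / (δ : ℝ)) ^ (2 + α)) ∧
    Schlicht.HasBoxDim (Schlicht.schlichtClass D) ⊤ := by
  obtain ⟨c, K, hc0, h⟩ := Schlicht.eventually_logCovering_schlichtClass_bounds hl0 hl1 hα
    hlam.isBigO hr.isBigO_symm
  have hpos := Schlicht.tendsto_log_one_div_nhdsGT_zero.eventually_gt_atTop 0
  refine ⟨fun δ hδ => ?_, ?_, ?_, ?_⟩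
  -- Finiteness at some smaller radius suffices, as covering numbers decrease in the radius.
  · obtain ⟨δ', ⟨M, -, hM, -⟩, hδ'⟩ := (h.and (Ioo_mem_nhdsGT hδ)).exists
    refine ((Metric.coveringNumber_anti hδ'.2.le).trans_lt ?_).ne
    rw [hM]
    exact ENat.natCast_lt_top M
  · refine IsBigO.of_bound c⁻¹ ?_
    filter_upwards [h] with δ ⟨M, _, hM, hlo, _⟩
    rw [Schlicht.logCovering, hM, ENat.toNat_natCast, Real.norm_of_nonneg (by positivity),
      Real.norm_of_nonneg (Real.log_natCast_nonneg M), inv_mul_eq_div, le_div_iff₀ hc0]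
    linarith
  · refine IsBigO.of_bound K ?_
    filter_upwards [h, hpos] with δ ⟨M, _, hM, _, hup⟩ hL
    rw [Schlicht.logCovering, hM, ENat.toNat_natCast,
      Real.norm_of_nonneg (Real.log_natCast_nonneg M), Real.norm_of_nonneg (by positivity)]
    exact hup
  -- The quotient is at least `c * log (1/δ)`, which tends to infinity.
  · refine EReal.tendsto_nhds_top_iff_real.2 fun x => ?_
    filter_upwards [h, hpos, Schlicht.tendsto_log_one_div_nhdsGT_zero.eventually_gt_atTop (x / c)]
      with δ ⟨M, hM0, hM, hlo, _⟩ hL hx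
    have hlog : ENNReal.log (Metric.coveringNumber δ (Schlicht.schlichtClass D) : ℝ≥0∞) =
        ((Real.log M : ℝ) : EReal) := by
      have hM' : (0 : ℝ) < M := by exact_mod_cast hM0
      rw [hM, ENat.toENNReal_coe, ← ENNReal.ofReal_natCast, ENNReal.log_ofReal_of_pos hM']
    rw [hlog, ← EReal.coe_div, EReal.coe_lt_coe_iff, lt_div_iff₀ hL]
    rw [div_lt_iff₀ hc0] at hx
    nlinarith
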